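/- Let $\mathbb D$ be the open unit disk in $\mathbb C$, let $dA = r\,dr\,\frac{d\theta}{\pi}$ be the normalized Lebesgue measure on $\mathbb D$, and let $L^2_h$ be the harmonic Bergman space, that is, the closed subspace of $L^2(\mathbb D, dA)$ consisting of the (complex-valued) harmonic functions on $\mathbb D$ that are square integrable. Let $Q$ be the orthogonal projection of $L^2(\mathbb D, dA)$ onto $L^2_h$ and, for an (essentially) bounded measurable function $f$ on $\mathbb D$, let $T_f : L^2_h \to L^2_h$, $T_f(u) = Q(fu)$, be the Toeplitz operator with symbol $f$. Functions that agree almost everywhere are identified; in particular "constant" means equal almost everywhere to a constant. A function on $\mathbb D$ is radial if its value at $z$ depends only on $|z|$, and $e^{ip\theta}\phi$ denotes the function $re^{i\theta} \mapsto e^{ip\theta}\phi(re^{i\theta})$. Let $p$ be a nonzero integer, let $\phi$ be a non-constant bounded radial function on $\mathbb D$, and let $\psi$ be a bounded radial function on $\mathbb D$. If $T_\psi T_{e^{ip\theta}\phi} = T_{e^{ip\theta}\phi} T_\psi$ on $L^2_h$, then $\psi$ is a constant function. -/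

import Mathlib

open MeasureTheory Metric Filter Topology InnerProductSpace
open scoped ENNReal

namespace HarmonicBergman

/-- The normalized area measure `dA = r dr dθ / π` of the open unit disk, as a measure on `ℂ`. -/
noncomputable def diskMeasure : Measure ℂ :=
  ENNReal.ofReal (Real.pi⁻¹) • (volume : Measure ℂ).restrict (ball 0 1)

instance : IsProbabilityMeasure diskMeasure := by
  constructor
  simp only [diskMeasure, Measure.smul_apply, Measure.restrict_apply_univ, Complex.volume_ball,
    smul_eq_mul]
  simp only [ENNReal.ofReal_one, one_pow, one_mul]
  rw [ENNReal.ofReal_inv_of_pos Real.pi_pos]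
  have h : (NNReal.pi : ℝ≥0∞) = ENNReal.ofReal Real.pi := by
    rw [← NNReal.coe_real_pi, ENNReal.ofReal_coe_nnreal]
  rw [h]
  exact ENNReal.inv_mul_cancel (by simp [Real.pi_pos]) ENNReal.ofReal_ne_top

/-- The mean value property over disks. -/
theorem setIntegral_ball_eq {u : ℂ → ℂ} {z : ℂ} {r : ℝ} (hr : 0 < r)
    (hu : HarmonicOnNhd u (closedBall z r)) :
    ∫ w in ball z r, u w = (Real.pi * r ^ 2 : ℝ) • u z := by
  have hc : ContinuousOn u (closedBall z r) := hu.continuousOn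
  have h1 : ∫ w in ball z r, u w = ∫ w, (ball z r).indicator u (w + z) := by
    rw [integral_add_right_eq_self (fun w => (ball z r).indicator u w),
      integral_indicator measurableSet_ball]
  have hs : ∀ s ∈ Set.Ioo 0 r, (2 * Real.pi) • u z =
      ∫ θ in Set.Ioo (-Real.pi) Real.pi, u (circleMap z s θ) := by
    intro s hs
    have h := InnerProductSpace.HarmonicOnNhd.circleAverage_eq (f := u) (c := z) (R := s)
      (hu.mono (closedBall_subset_closedBall (by rw [abs_of_pos hs.1]; exact hs.2.le)))
    rw [← h, Real.circleAverage_eq_integral_add (-Real.pi), smul_smul,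
      mul_inv_cancel₀ (by positivity), one_smul,
      intervalIntegral.integral_comp_add_right (fun θ => u (circleMap z s θ)),
      intervalIntegral.integral_of_le (by linarith [Real.pi_pos]),
      integral_Ioc_eq_integral_Ioo]
    congr 3 <;> ring
  have hcm : ∀ p : ℝ × ℝ, Complex.polarCoord.symm p + z = circleMap z p.1 p.2 := by
    intro p
    simp [circleMap, Complex.polarCoord_symm_apply, Complex.exp_mul_I, add_comm]
  rw [h1, ← Complex.integral_comp_polarCoord_symm]
  have h2 : ∀ p ∈ polarCoord.target, p.1 • (ball z r).indicator u (Complex.polarCoord.symm p + z) =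
      (Set.Ioo (0:ℝ) r ×ˢ Set.Ioo (-Real.pi) Real.pi).indicator
        (fun p => p.1 • u (circleMap z p.1 p.2)) p := by
    rintro ⟨s, θ⟩ ⟨hs1, hs2⟩
    simp only [Set.mem_Ioi] at hs1 hs2
    rw [hcm]
    by_cases h : s < r
    · rw [Set.indicator_of_mem, Set.indicator_of_mem]
      · exact ⟨⟨hs1, h⟩, hs2⟩
      · simp [circleMap, abs_of_pos hs1, h]
    · rw [Set.indicator_of_notMem, Set.indicator_of_notMem, smul_zero]
      · intro h'; exact h h'.1.2
      · simp [circleMap, abs_of_pos hs1, h]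
  rw [setIntegral_congr_fun (by exact polarCoord.open_target.measurableSet) h2,
    setIntegral_indicator (measurableSet_Ioo.prod measurableSet_Ioo)]
  have h3 : polarCoord.target ∩ (Set.Ioo (0:ℝ) r ×ˢ Set.Ioo (-Real.pi) Real.pi) =
      Set.Ioo (0:ℝ) r ×ˢ Set.Ioo (-Real.pi) Real.pi := by
    apply Set.inter_eq_right.2
    rintro ⟨s, θ⟩ ⟨hs1, hs2⟩
    exact ⟨hs1.1, hs2⟩
  rw [h3, Measure.volume_eq_prod, setIntegral_prod]
  · have h4 : ∀ s ∈ Set.Ioo (0:ℝ) r,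
        ∫ θ in Set.Ioo (-Real.pi) Real.pi, s • u (circleMap z s θ) =
          s • (2 * Real.pi) • u z := by
      intro s h
      rw [integral_smul, hs s h]
    rw [setIntegral_congr_fun measurableSet_Ioo h4, integral_smul_const,
      ← integral_Ioc_eq_integral_Ioo, ← intervalIntegral.integral_of_le hr.le, integral_id,
      smul_smul]
    congr 1
    ring
  · have : IntegrableOn (fun p : ℝ × ℝ => p.1 • u (circleMap z p.1 p.2))
        (Set.Icc (0:ℝ) r ×ˢ Set.Icc (-Real.pi) Real.pi) := by
      apply ContinuousOn.integrableOn_compact (isCompact_Icc.prod isCompact_Icc)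
      apply ContinuousOn.smul continuousOn_fst
      apply hc.comp
      · have : Continuous fun p : ℝ × ℝ => circleMap z p.1 p.2 := by
          unfold circleMap
          fun_prop
        exact this.continuousOn
      · rintro ⟨s, θ⟩ ⟨hs1, -⟩
        simp only [Set.mem_Icc] at hs1
        simp [circleMap, abs_of_nonneg hs1.1, hs1.2]
    exact this.mono_set (Set.prod_mono Set.Ioo_subset_Icc_self Set.Ioo_subset_Icc_self)

/-- A uniform limit of harmonic functions on a closed disk is harmonic on the open disk. -/
theorem harmonicOnNhd_of_tendstoUniformlyOn {u : ℕ → ℂ → ℝ} {g : ℂ → ℝ} {R : ℝ} (hR : 0 < R)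
    (hu : ∀ n, HarmonicOnNhd (u n) (closedBall 0 R))
    (hg : TendstoUniformlyOn u g atTop (closedBall 0 R)) : HarmonicOnNhd g (ball 0 R) := by
  have hgc : ContinuousOn g (closedBall 0 R) :=
    hg.continuousOn (Eventually.of_forall fun n => (hu n).continuousOn).frequently
  have hsub : sphere (0:ℂ) |R| ⊆ closedBall 0 R := by
    rw [abs_of_pos hR]; exact sphere_subset_closedBall
  have hgI : CircleIntegrable (fun z => (g z : ℂ)) 0 R :=
    (Complex.continuous_ofReal.comp_continuousOn (hgc.mono hsub)).circleIntegrable'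
  have hk : ∀ w ∈ ball (0:ℂ) R, ContinuousOn (herglotzRieszKernel 0 w) (sphere 0 |R|) := by
    intro w hw
    rw [herglotzRieszKernel_fun_def]
    apply ContinuousOn.div (by fun_prop) (by fun_prop)
    intro ζ hζ h
    simp only [sub_zero, sub_eq_zero] at h
    subst h
    simp only [mem_sphere, abs_of_pos hR, mem_ball] at hζ hw
    linarith
  -- the Poisson formula passes to the limit
  have hP : ∀ w ∈ ball (0:ℂ) R,
      Real.circleAverage ((Complex.re ∘ herglotzRieszKernel 0 w) • g) 0 R = g w := by
    intro w hw
    have hkr : ContinuousOn (Complex.re ∘ herglotzRieszKernel 0 w) (sphere 0 |R|) :=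
      Complex.continuous_re.comp_continuousOn (hk w hw)
    obtain ⟨C, hC⟩ := (isCompact_sphere (0:ℂ) |R|).exists_bound_of_continuousOn hkr
    have h1 : Tendsto (fun n => u n w) atTop (𝓝 (g w)) :=
      hg.tendsto_at (ball_subset_closedBall hw)
    have h2 : Tendsto (fun n => u n w) atTop
        (𝓝 (Real.circleAverage ((Complex.re ∘ herglotzRieszKernel 0 w) • g) 0 R)) := by
      rw [Metric.tendsto_atTop]
      intro ε hε
      have hC0 : 0 < |C| + 1 := by positivity
      obtain ⟨N, hN⟩ := eventually_atTop.1
        (Metric.tendstoUniformlyOn_iff.1 hg (ε / 2 / (|C| + 1)) (by positivity))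
      refine ⟨N, fun n hn => ?_⟩
      rw [← (hu n).circleAverage_re_herglotzRieszKernel_smul hw, Real.dist_eq,
        ← Real.circleAverage_sub
          (hkr.smul ((hu n).continuousOn.mono hsub)).circleIntegrable'
          (hkr.smul (hgc.mono hsub)).circleIntegrable']
      refine lt_of_le_of_lt (Real.abs_circleAverage_le_circleAverage_abs) ?_
      refine lt_of_le_of_lt (Real.circleAverage_mono_on_of_le_circle (a := ε / 2) ?_ ?_)
        (by linarith)
      · apply ContinuousOn.circleIntegrable'
        exact ((hkr.smul ((hu n).continuousOn.mono hsub)).sub (hkr.smul (hgc.mono hsub))).abs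
      · intro ζ hζ
        have e1 := hN n hn ζ (hsub hζ)
        have e2 := hC ζ hζ
        rw [Real.dist_eq, abs_sub_comm] at e1
        rw [Real.norm_eq_abs] at e2
        have e3 : |(Complex.re ∘ herglotzRieszKernel 0 w) • u n -
            (Complex.re ∘ herglotzRieszKernel 0 w) • g| ζ =
            |(Complex.re ∘ herglotzRieszKernel 0 w) ζ| * |u n ζ - g ζ| := by
          rw [← abs_mul, mul_sub]
          rfl
        rw [e3]
        calc _ ≤ (|C| + 1) * (ε / 2 / (|C| + 1)) := by
              apply mul_le_mul _ e1.le (abs_nonneg _) hC0.le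
              linarith [le_abs_self C]
          _ = ε / 2 := by field_simp
    exact tendsto_nhds_unique h2 h1
  -- the limit is the real part of a Cauchy type integral
  lift R to NNReal using hR.le
  have hF := (hasFPowerSeriesOn_cauchy_integral (f := fun z => (g z : ℂ)) (c := 0) (R := R) hgI
    (by exact_mod_cast hR)).analyticOnNhd
  set F : ℂ → ℂ := fun w => (2 * Real.pi * Complex.I : ℂ)⁻¹ • ∮ z in C(0, R), (z - w)⁻¹ • (g z : ℂ)
    with hFdef
  set c0 : ℂ := Real.circleAverage (fun z => (g z : ℂ)) 0 R with hc0
  have hA : ∀ w ∈ ball (0:ℂ) R, AnalyticAt ℂ (fun w => 2 * F w - c0) w := by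
    intro w hw
    have := hF w (by simpa [Metric.eball_coe] using hw)
    fun_prop
  have hEq : ∀ w ∈ ball (0:ℂ) R, g w = (2 * F w - c0).re := by
    intro w hw
    have hI : CircleIntegrable (herglotzRieszKernel 0 w • fun z => (g z : ℂ)) 0 R :=
      ((hk w hw).smul (Complex.continuous_ofReal.comp_continuousOn
        (hgc.mono hsub))).circleIntegrable'
    have hw' : ∀ ζ ∈ sphere (0:ℂ) |(R:ℝ)|, ζ - w ≠ 0 := by
      intro ζ hζ h
      rw [sub_eq_zero] at h
      subst h
      simp only [mem_sphere, abs_of_pos hR, mem_ball] at hζ hw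
      linarith
    have e1 : F w = Real.circleAverage (fun z => (z / (z - w)) * (g z : ℂ)) 0 R := by
      rw [Real.circleAverage_eq_circleIntegral hR.ne', hFdef]
      simp only [sub_zero, smul_eq_mul]
      congr 1
      · apply circleIntegral.integral_congr hR.le
        intro ζ hζ
        have h0 : ζ ≠ 0 := by
          rintro rfl
          simp only [mem_sphere, dist_self] at hζ
          linarith
        simp only
        field_simp
    have hI2 : CircleIntegrable (fun z => (z / (z - w)) * (g z : ℂ)) 0 R := by
      apply ContinuousOn.circleIntegrable'
      apply ContinuousOn.mul _ (Complex.continuous_ofReal.comp_continuousOn (hgc.mono hsub))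
      exact ContinuousOn.div (by fun_prop) (by fun_prop) hw'
    have e2 : 2 * F w - c0 =
        Real.circleAverage (herglotzRieszKernel 0 w • fun z => (g z : ℂ)) 0 R := by
      rw [e1, hc0, ← smul_eq_mul, ← Real.circleAverage_fun_smul (a := (2:ℂ)),
        ← Real.circleAverage_fun_sub _ hgI]
      · apply Real.circleAverage_congr_sphere
        intro ζ hζ
        have := hw' ζ hζ
        simp only [herglotzRieszKernel_def, Pi.smul_apply', smul_eq_mul, sub_zero]
        field_simp
        ring
      · exact hI2.const_smul (a := (2:ℂ))
    rw [e2, ← hP w hw]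
    have := Complex.reCLM.circleAverage_comp_comm hI
    simp only [Complex.reCLM_apply] at this
    rw [← this]
    apply Real.circleAverage_congr_sphere
    intro ζ hζ
    simp
  intro w hw
  have h := (hA w hw).harmonicAt_re
  refine (harmonicAt_congr_nhds ?_).1 h
  filter_upwards [isOpen_ball.mem_nhds hw] with y hy
  exact (hEq y hy).symm

/-- The harmonic Bergman space `L²_h`: the classes in `L²(𝔻, dA)` of the square integrable
(complex valued) harmonic functions on the open unit disk. -/
noncomputable def harmonicBergman : Submodule ℂ (Lp ℂ 2 diskMeasure) where
  carrier := {f | ∃ u : ℂ → ℂ, HarmonicOnNhd u (ball 0 1) ∧ f =ᵐ[diskMeasure] u}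
  zero_mem' := ⟨fun _ => 0, by
    intro x _
    exact harmonicAt_const 0, Lp.coeFn_zero ℂ 2 diskMeasure⟩
  add_mem' := by
    rintro f g ⟨u, hu, hfu⟩ ⟨v, hv, hgv⟩
    exact ⟨u + v, hu.add hv, (Lp.coeFn_add f g).trans (hfu.add hgv)⟩
  smul_mem' := by
    rintro c f ⟨u, hu, hfu⟩
    refine ⟨(c • ContinuousLinearMap.id ℝ ℂ) ∘ u, hu.comp_CLM _, (Lp.coeFn_smul c f).trans ?_⟩
    filter_upwards [hfu] with z hz
    simp [hz]

theorem smul_eq_inner {f : Lp ℂ 2 diskMeasure} {u : ℂ → ℂ} (hu : HarmonicOnNhd u (ball 0 1))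
    (hfu : f =ᵐ[diskMeasure] u) {z : ℂ} {r : ℝ} (hr : 0 < r) (hz : ‖z‖ + r < 1) :
    (r ^ 2 : ℝ) • u z = inner ℂ (indicatorConstLp 2 (measurableSet_ball (x := z) (ε := r))
      (measure_ne_top diskMeasure _) (1 : ℂ)) f := by
  have hsub : closedBall z r ⊆ ball 0 1 := by
    apply closedBall_subset_ball'
    simpa [add_comm] using hz
  rw [L2.inner_indicatorConstLp_one measurableSet_ball,
    integral_congr_ae (ae_restrict_of_ae hfu), diskMeasure, Measure.restrict_smul,
    integral_smul_measure, Measure.restrict_restrict measurableSet_ball,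
    Set.inter_eq_left.2 (ball_subset_closedBall.trans hsub), setIntegral_ball_eq hr (hu.mono hsub),
    smul_smul, ENNReal.toReal_ofReal (by positivity)]
  congr 1
  field_simp

theorem isClosed_harmonicBergman :
    IsClosed (harmonicBergman : Set (Lp ℂ 2 diskMeasure)) := by
  apply IsSeqClosed.isClosed
  intro f f0 hf hlim
  choose u hu hfu using hf
  set ind : ℂ → ℝ → Lp ℂ 2 diskMeasure := fun z r =>
    indicatorConstLp 2 (measurableSet_ball (x := z) (ε := r))
      (measure_ne_top diskMeasure _) (1 : ℂ) with hind
  have hindn : ∀ z r, ‖ind z r‖ ≤ 1 := by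
    intro z r
    rw [hind, norm_indicatorConstLp (by norm_num) (by norm_num), norm_one, one_mul]
    exact Real.rpow_le_one measureReal_nonneg measureReal_le_one (by norm_num)
  have hkey : ∀ z r, 0 < r → ‖z‖ + r < 1 → ∀ n m,
      ‖u n z - u m z‖ ≤ (r ^ 2)⁻¹ * ‖f n - f m‖ := by
    intro z r hr hz n m
    have h1 := smul_eq_inner (hu n) (hfu n) hr hz
    have h2 := smul_eq_inner (hu m) (hfu m) hr hz
    have h3 : (r ^ 2 : ℝ) • (u n z - u m z) = inner ℂ (ind z r) (f n - f m) := by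
      rw [smul_sub, h1, h2, inner_sub_right]
    have h4 : r ^ 2 * ‖u n z - u m z‖ ≤ ‖f n - f m‖ := by
      have := norm_inner_le_norm (𝕜 := ℂ) (ind z r) (f n - f m)
      rw [← h3, norm_smul, Real.norm_of_nonneg (by positivity)] at this
      exact this.trans (mul_le_of_le_one_left (norm_nonneg _) (hindn z r))
    rw [inv_mul_eq_div, le_div_iff₀ (by positivity)]
    linarith
  have hC : CauchySeq f := hlim.cauchySeq
  have hunif : ∀ R : ℝ, 0 < R → R < 1 → UniformCauchySeqOn u atTop (closedBall 0 R) := by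
    intro R hR0 hR
    rw [Metric.uniformCauchySeqOn_iff]
    intro ε hε
    set r := (1 - R) / 2 with hr
    have hr0 : 0 < r := by linarith
    obtain ⟨N, hN⟩ := Metric.cauchySeq_iff.1 hC (r ^ 2 * ε) (by positivity)
    refine ⟨N, fun m hm n hn z hz => ?_⟩
    rw [dist_eq_norm]
    refine lt_of_le_of_lt (hkey z r hr0 (by simp at hz; linarith) m n) ?_
    have := hN m hm n hn
    rw [dist_eq_norm] at this
    rw [inv_mul_eq_div, div_lt_iff₀ (by positivity)]
    linarith
  have hpt : ∀ z ∈ ball (0:ℂ) 1, ∃ l, Tendsto (fun n => u n z) atTop (𝓝 l) := by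
    intro z hz
    simp only [mem_ball, dist_zero_right] at hz
    apply cauchySeq_tendsto_of_complete
    exact (hunif ((‖z‖ + 1) / 2) (by positivity) (by linarith)).cauchySeq
      (by simp; linarith)
  choose! g hg using hpt
  have hgu : ∀ R : ℝ, 0 < R → R < 1 → TendstoUniformlyOn u g atTop (closedBall 0 R) := by
    intro R hR0 hR
    exact (hunif R hR0 hR).tendstoUniformlyOn_of_tendsto
      (fun z hz => hg z (closedBall_subset_ball hR hz))
  refine ⟨g, ?_, ?_⟩
  · intro z hz
    simp only [mem_ball, dist_zero_right] at hz
    set R := (‖z‖ + 1) / 2 with hRdef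
    have hR0 : 0 < R := by positivity
    have hR1 : R < 1 := by linarith
    have hsub : closedBall (0:ℂ) R ⊆ ball 0 1 := closedBall_subset_ball hR1
    have hre : HarmonicOnNhd (fun w => (g w).re) (ball 0 R) := by
      apply harmonicOnNhd_of_tendstoUniformlyOn hR0
        (u := fun n w => (u n w).re) (fun n => ((hu n).mono hsub).comp_CLM Complex.reCLM)
      exact Complex.reCLM.uniformContinuous.comp_tendstoUniformlyOn (hgu R hR0 hR1)
    have him : HarmonicOnNhd (fun w => (g w).im) (ball 0 R) := by
      apply harmonicOnNhd_of_tendstoUniformlyOn hR0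
        (u := fun n w => (u n w).im) (fun n => ((hu n).mono hsub).comp_CLM Complex.imCLM)
      exact Complex.imCLM.uniformContinuous.comp_tendstoUniformlyOn (hgu R hR0 hR1)
    have hzR : z ∈ ball (0:ℂ) R := by simp; linarith
    have h1 := (hre z hzR).comp_CLM Complex.ofRealCLM
    have h2 := (him z hzR).comp_CLM (Complex.I • Complex.ofRealCLM)
    convert h1.add h2 using 1
    ext w
    simp [mul_comm Complex.I]
  · obtain ⟨ns, hns, hae⟩ := (tendstoInMeasure_of_tendsto_Lp hlim).exists_seq_tendsto_ae
    have hball : ∀ᵐ z ∂diskMeasure, z ∈ ball (0:ℂ) 1 :=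
      Measure.ae_smul_measure (ae_restrict_mem measurableSet_ball) _
    filter_upwards [hae, hball, ae_all_iff.2 hfu] with z h1 h2 h3
    refine tendsto_nhds_unique h1 ?_
    simp only [h3]
    exact (hg z h2).comp hns.tendsto_atTop

instance : CompleteSpace harmonicBergman := isClosed_harmonicBergman.completeSpace_coe

/-- The Toeplitz operator `T_f u = Q (f u)` on `L²_h`, where `Q` is the orthogonal projection
of `L²(𝔻, dA)` onto `L²_h` and `f` is a bounded symbol. -/
noncomputable def toeplitz (f : ℂ → ℂ) (hf : MemLp f ∞ diskMeasure) :
    harmonicBergman →L[ℂ] harmonicBergman :=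
  harmonicBergman.orthogonalProjectionOnto ∘L
    (ContinuousLinearMap.mul ℂ ℂ).holderL diskMeasure ∞ 2 2 (hf.toLp f) ∘L
      harmonicBergman.subtypeL

/-- `f` is radial on the unit disk: `f z` depends only on `‖z‖`. -/
def IsRadial (f : ℂ → ℂ) : Prop :=
  ∀ z ∈ ball (0 : ℂ) 1, ∀ w ∈ ball (0 : ℂ) 1, ‖z‖ = ‖w‖ → f z = f w

/-- The quasihomogeneous symbol `e^{ipθ} φ`, where `θ` is the argument of the variable. -/
noncomputable def quasihomogeneous (p : ℤ) (φ : ℂ → ℂ) (z : ℂ) : ℂ :=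
  Complex.exp (Complex.I * p * Complex.arg z) * φ z

theorem memLp_quasihomogeneous (p : ℤ) {φ : ℂ → ℂ} (hφ : MemLp φ ∞ diskMeasure) :
    MemLp (quasihomogeneous p φ) ∞ diskMeasure := by
  have hm : Measurable fun z : ℂ => Complex.exp (Complex.I * p * Complex.arg z) := by
    have := Complex.measurable_arg
    fun_prop
  refine hφ.of_le (hm.aestronglyMeasurable.mul hφ.1) (Eventually.of_forall fun z => ?_)
  have : Complex.I * p * Complex.arg z = ((p * Complex.arg z : ℝ) : ℂ) * Complex.I := by
    push_cast; ring
  rw [quasihomogeneous, this, norm_mul, Complex.norm_exp_ofReal_mul_I, one_mul]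

/-- The symbol acts by pointwise multiplication, followed by the projection. -/
theorem toeplitz_apply (f : ℂ → ℂ) (hf : MemLp f ∞ diskMeasure) (u : harmonicBergman)
    (v : Lp ℂ 2 diskMeasure) (hv : v =ᵐ[diskMeasure] fun z => f z * (u : Lp ℂ 2 diskMeasure) z) :
    toeplitz f hf u = harmonicBergman.orthogonalProjectionOnto v := by
  have : (ContinuousLinearMap.mul ℂ ℂ).holderL diskMeasure ∞ 2 2 (hf.toLp f)
      (u : Lp ℂ 2 diskMeasure) = v := by
    apply Lp.ext
    refine Filter.EventuallyEq.trans ?_ hv.symm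
    filter_upwards [(ContinuousLinearMap.mul ℂ ℂ).coeFn_holder (r := 2) (hf.toLp f)
      (u : Lp ℂ 2 diskMeasure), hf.coeFn_toLp] with z h1 h2
    rw [ContinuousLinearMap.holderL_apply_apply, h1, h2]
    rfl
  simp [toeplitz, this]

end HarmonicBergman

/-! Both operators are explicit on the harmonic monomials e_k = r^|k| e^{ikθ}: T_ψ is diagonal with
eigenvalue λ(|k|), where λ(n) = (n+1)∫ψ|z|^{2n} dA, and ⟨e_{k+p}, T_{e^{ipθ}φ} e_k⟩ is a moment of
φ. Comparing matrix coefficients of the two products, with k of the same sign as p and q = |p|,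
gives for every n (∫φ|z|^{2n+q} dA)·(λ(n+q) − λ(n)) = 0 (`eigenvalue_sub_mul_eq_zero_of_commute`).

A priori each factor could vanish on its own set of integers. After division by (n+1)(n+q+1) the
product is the n-th moment of a single functional on C([0,1]), a multiplicative convolution. Its
moments all vanish, so by Weierstrass it is zero, hence it also kills t^s for Re s > 0. There it is
a product of two holomorphic functions of s, so one factor vanishes identically
(`moments_dichotomy`).

If the φ-factor vanishes, then φ = 0 almost everywhere, which is excluded. Otherwise λ is q-periodic
from index 1 on; since λ(n+1) − λ(n) = O(1/n), it is constant there (`radialEigenvalue_succ_eq`).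
Then ψ − λ(1) has vanishing radial moments, so ψ = λ(1) almost everywhere. -/

namespace HarmonicBergman

/-! ### Functionals on `C([0, 1])` and their multiplicative convolution -/

/-- The multiplicative convolution of two functionals on `C([0, 1])`. -/
noncomputable def mulConv (L M : C(unitInterval, ℂ) →L[ℂ] ℂ) : C(unitInterval, ℂ) →L[ℂ] ℂ where
  toFun g := L (M.compLeftContinuous ℂ unitInterval
    (g.comp ⟨fun x : unitInterval × unitInterval => x.1 * x.2, continuous_mul⟩).curry)
  map_add' g h := by
    rw [← map_add, ← map_add]
    rfl
  map_smul' c g := by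
    rw [← map_smul, ← map_smul]
    rfl
  cont := L.continuous.comp ((M.compLeftContinuous ℂ unitInterval).continuous.comp
    (ContinuousMap.continuous_curry.comp (ContinuousMap.continuous_precomp _)))

/-- If g(st) = g(s)g(t), the inner functional returns M g · g(s). Only multiplicativity of g is
used, so the formula covers integer and complex powers alike; this carries a relation from the
exponents n to the exponents s. -/
theorem mulConv_apply_of_map_mul (L M : C(unitInterval, ℂ) →L[ℂ] ℂ) {g : C(unitInterval, ℂ)}
    (hg : ∀ s t, g (s * t) = g s * g t) : mulConv L M g = L g * M g := by
  have h : M.compLeftContinuous ℂ unitInterval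
      (g.comp ⟨fun x : unitInterval × unitInterval => x.1 * x.2, continuous_mul⟩).curry =
      M g • g := by
    ext s
    have : (g.comp ⟨fun x : unitInterval × unitInterval => x.1 * x.2, continuous_mul⟩).curry s =
        g s • g := by
      ext t
      simp [hg]
    change M ((g.comp
      ⟨fun x : unitInterval × unitInterval => x.1 * x.2, continuous_mul⟩).curry s) = _
    rw [this, map_smul]
    simp [mul_comm]
  change L (M.compLeftContinuous ℂ unitInterval _) = _
  rw [h, map_smul, smul_eq_mul, mul_comm]

/-- The monomial `t ^ n` on `[0, 1]`. -/
noncomputable def monomialI (n : ℕ) : C(unitInterval, ℂ) :=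
  ⟨fun t => ((t : ℝ) : ℂ) ^ n, by fun_prop⟩

/-- The power `t ^ s` on `[0, 1]`. -/
noncomputable def cpowI (s : ℂ) (hs : 0 < s.re) : C(unitInterval, ℂ) :=
  ⟨fun t => ((t : ℝ) : ℂ) ^ s,
    (Complex.continuous_ofReal_cpow_const hs).comp continuous_subtype_val⟩

theorem monomialI_mul (n : ℕ) (s t : unitInterval) :
    monomialI n (s * t) = monomialI n s * monomialI n t := by
  simp [monomialI, mul_pow]

theorem cpowI_mul (z : ℂ) (hz : 0 < z.re) (s t : unitInterval) :
    cpowI z hz (s * t) = cpowI z hz s * cpowI z hz t := by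
  simpa [cpowI] using Complex.mul_cpow_ofReal_nonneg s.2.1 t.2.1 z

theorem cpowI_natCast (n : ℕ) (hn : 0 < (n : ℂ).re) : cpowI n hn = monomialI n := by
  ext t
  simp [cpowI, monomialI]

/-- A functional on `C([0, 1])` is determined by its moments. -/
theorem eq_zero_of_moments {L : C(unitInterval, ℂ) →L[ℂ] ℂ} (h : ∀ n, L (monomialI n) = 0) :
    L = 0 := by
  let J : C(unitInterval, ℝ) →L[ℝ] C(unitInterval, ℂ) :=
    Complex.ofRealCLM.compLeftContinuous ℝ unitInterval
  let K : C(unitInterval, ℝ) →L[ℝ] ℂ := (L.restrictScalars ℝ).comp J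
  -- Weierstrass approximation handles real-valued functions; complex ones are split into real and
  -- imaginary parts.
  have hK : ∀ g, K g = 0 := by
    intro g
    have hg : g ∈ (polynomialFunctions (Set.Icc (0:ℝ) 1)).topologicalClosure := by
      rw [polynomialFunctions_closure_eq_top]
      trivial
    have hcl : IsClosed {g : C(unitInterval, ℝ) | K g = 0} :=
      isClosed_eq K.continuous continuous_const
    refine closure_minimal ?_ hcl hg
    rintro _ ⟨P, -, rfl⟩
    simp only [Set.mem_ofPred_eq]
    induction P using Polynomial.induction_on' with
    | add P Q hP hQ =>
      rw [RingHom.coe_coe] at hP hQ ⊢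
      rw [map_add, map_add, hP, hQ, add_zero]
    | monomial n a =>
      have : J (Polynomial.toContinuousMapOn (Polynomial.monomial n a) unitInterval) =
          (a : ℂ) • monomialI n := by
        ext t
        simp [J, monomialI]
      change L (J (Polynomial.toContinuousMapOn (Polynomial.monomial n a) unitInterval)) = 0
      rw [this, map_smul, h, smul_zero]
  ext g
  have hd : g = J ((ContinuousMap.mk Complex.re Complex.continuous_re).comp g) +
      Complex.I • J ((ContinuousMap.mk Complex.im Complex.continuous_im).comp g) := by
    ext t
    simp [J, mul_comm Complex.I]
  rw [hd, map_add, map_smul]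
  have h1 := hK ((ContinuousMap.mk Complex.re Complex.continuous_re).comp g)
  have h2 := hK ((ContinuousMap.mk Complex.im Complex.continuous_im).comp g)
  change L (J _) = 0 at h1 h2
  rw [h1, h2]
  simp

/-- The squared modulus as a point of `[0, 1]`. -/
noncomputable def sqNormI (z : ℂ) : unitInterval := Set.projIcc 0 1 zero_le_one (‖z‖ ^ 2)

theorem continuous_sqNormI : Continuous sqNormI := by
  unfold sqNormI
  exact continuous_projIcc.comp (by fun_prop)

theorem ae_mem_ball : ∀ᵐ z ∂diskMeasure, z ∈ ball (0:ℂ) 1 :=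
  Measure.ae_smul_measure (ae_restrict_mem measurableSet_ball) _

theorem coe_sqNormI {z : ℂ} (hz : z ∈ ball (0:ℂ) 1) : (sqNormI z : ℝ) = ‖z‖ ^ 2 := by
  have : ‖z‖ ^ 2 ∈ Set.Icc (0:ℝ) 1 :=
    ⟨by positivity, pow_le_one₀ (norm_nonneg _) (by simpa using (mem_ball_zero_iff.1 hz).le)⟩
  rw [sqNormI, Set.projIcc_of_mem _ this]

theorem integrable_mul_comp {X : Type*} [TopologicalSpace X] [CompactSpace X] [MeasurableSpace X]
    [BorelSpace X] {μ : Measure ℂ} {t : ℂ → X} (ht : Measurable t) {h : ℂ → ℂ}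
    (hh : Integrable h μ) (g : C(X, ℂ)) : Integrable (fun z => h z * g (t z)) μ :=
  hh.mul_bdd (c := ‖g‖) (g.continuous.measurable.comp ht).aestronglyMeasurable
    (Eventually.of_forall fun _ => g.norm_coe_le_norm _)

/-- The functional `g ↦ ∫ h(z) g(t(z)) dμ(z)`. -/
noncomputable def integralFunctional {X : Type*} [TopologicalSpace X] [CompactSpace X]
    [MeasurableSpace X] [BorelSpace X] {μ : Measure ℂ} {t : ℂ → X} (ht : Measurable t)
    {h : ℂ → ℂ} (hh : Integrable h μ) : C(X, ℂ) →L[ℂ] ℂ :=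
  LinearMap.mkContinuous
    { toFun := fun g => ∫ z, h z * g (t z) ∂μ
      map_add' := fun f g => by
        simp only [ContinuousMap.add_apply, mul_add]
        exact integral_add (integrable_mul_comp ht hh f) (integrable_mul_comp ht hh g)
      map_smul' := fun c g => by
        simp only [ContinuousMap.smul_apply, smul_eq_mul, RingHom.id_apply, mul_left_comm _ c]
        exact integral_const_mul _ _ }
    (∫ z, ‖h z‖ ∂μ) (fun g => by
      rw [← integral_mul_const]
      refine (norm_integral_le_integral_norm _).trans
        (integral_mono (integrable_mul_comp ht hh g).norm (hh.norm.mul_const _) fun z => ?_)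
      simp only [norm_mul]
      gcongr
      exact g.norm_coe_le_norm _)

theorem integralFunctional_apply {X : Type*} [TopologicalSpace X] [CompactSpace X]
    [MeasurableSpace X] [BorelSpace X] {μ : Measure ℂ} {t : ℂ → X} (ht : Measurable t)
    {h : ℂ → ℂ} (hh : Integrable h μ) (g : C(X, ℂ)) :
    integralFunctional ht hh g = ∫ z, h z * g (t z) ∂μ := rfl

/-- The functional `g ↦ ∫ h(z) g(|z|²) dA(z)`. -/
noncomputable def radialFunctional (h : ℂ → ℂ) (hh : Integrable h diskMeasure) :
    C(unitInterval, ℂ) →L[ℂ] ℂ :=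
  integralFunctional continuous_sqNormI.measurable hh

theorem radialFunctional_apply {h : ℂ → ℂ} (hh : Integrable h diskMeasure)
    (g : C(unitInterval, ℂ)) :
    radialFunctional h hh g = ∫ z, h z * g (sqNormI z) ∂diskMeasure := rfl

theorem radialFunctional_monomialI {h : ℂ → ℂ} (hh : Integrable h diskMeasure) (n : ℕ) :
    radialFunctional h hh (monomialI n) = ∫ z, h z * ‖z‖ ^ (2 * n) ∂diskMeasure := by
  rw [radialFunctional_apply]
  apply integral_congr_ae
  filter_upwards [ae_mem_ball] with z hz
  simp [monomialI, coe_sqNormI hz, pow_mul]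

/-- The Mellin type transform `s ↦ ∫ h(z) (|z|²)ˢ dA(z)` is holomorphic on the right half plane. -/
theorem differentiableOn_radialFunctional_cpow {h : ℂ → ℂ} (hh : Integrable h diskMeasure) :
    DifferentiableOn ℂ (fun s : ℂ => ∫ z, h z * ((sqNormI z : ℝ) : ℂ) ^ s ∂diskMeasure)
      {s : ℂ | 0 < s.re} := by
  intro s hs
  simp only [Set.mem_ofPred_eq] at hs
  have hmeas : ∀ s : ℂ, AEStronglyMeasurable (fun z => ((sqNormI z : ℝ) : ℂ) ^ s) diskMeasure := by
    intro s
    have : Measurable fun z => (sqNormI z : ℝ) :=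
      (continuous_subtype_val.comp continuous_sqNormI).measurable
    exact (by fun_prop : Measurable fun z => ((sqNormI z : ℝ) : ℂ) ^ s).aestronglyMeasurable
  have hn0 : ∀ z, 0 ≤ (sqNormI z : ℝ) := fun z => (sqNormI z).2.1
  have hn1 : ∀ z, (sqNormI z : ℝ) ≤ 1 := fun z => (sqNormI z).2.2
  have hU : {w : ℂ | s.re / 2 < w.re} ∈ 𝓝 s :=
    (isOpen_lt continuous_const Complex.continuous_re).mem_nhds (by simp; linarith)
  -- On Re w > Re s / 2 one has |t^w log t| ≤ 1/Re w ≤ 2/Re s for 0 < t ≤ 1. At t = 0 the convention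
  -- log 0 = 0 makes the left side zero.
  have hbound : ∀ z, ∀ w ∈ {w : ℂ | s.re / 2 < w.re},
      ‖((sqNormI z : ℝ) : ℂ) ^ w * Complex.log (sqNormI z : ℝ)‖ ≤ 1 / (s.re / 2) := by
    intro z w hw
    simp only [Set.mem_ofPred_eq] at hw
    have hw0 : 0 < w.re := by linarith
    rcases (hn0 z).eq_or_lt with h0 | h0
    · rw [← h0]
      simp; positivity
    · rw [← Complex.ofReal_log h0.le, norm_mul, Complex.norm_cpow_eq_rpow_re_of_pos h0,
        Complex.norm_real, Real.norm_eq_abs, mul_comm,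
        ← abs_of_nonneg (Real.rpow_nonneg h0.le w.re), ← abs_mul]
      refine (Real.abs_log_mul_self_rpow_lt _ _ h0 (hn1 z) hw0).le.trans ?_
      gcongr
  refine (hasDerivAt_integral_of_dominated_loc_of_deriv_le (s := {w : ℂ | s.re / 2 < w.re})
    (F' := fun w z => h z * (((sqNormI z : ℝ) : ℂ) ^ w * Complex.log (sqNormI z : ℝ)))
    (bound := fun z => ‖h z‖ * (1 / (s.re / 2))) hU
    (Eventually.of_forall fun w => hh.1.mul (hmeas w))
    (integrable_mul_comp continuous_sqNormI.measurable hh (cpowI s hs)) ?_ ?_ (hh.norm.mul_const _)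
    ?_).2.differentiableAt.differentiableWithinAt
  · refine hh.1.mul ((hmeas s).mul ?_)
    have : Measurable fun z => (sqNormI z : ℝ) :=
      (continuous_subtype_val.comp continuous_sqNormI).measurable
    exact (by fun_prop : Measurable fun z => Complex.log (sqNormI z : ℝ)).aestronglyMeasurable
  · refine Eventually.of_forall fun z w hw => ?_
    rw [norm_mul]
    gcongr
    exact hbound z w hw
  · refine Eventually.of_forall fun z w hw => ?_
    simp only [Set.mem_ofPred_eq] at hw
    apply HasDerivAt.const_mul
    apply (hasDerivAt_id w).const_cpow ?_ |>.congr_deriv (by simp)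
    right
    rintro rfl
    simp at hw
    linarith

/-! ### Integrals over the disk and rotations -/

theorem integral_diskMeasure_rotation (a : Circle) (g : ℂ → ℂ) :
    ∫ z, g (a * z) ∂diskMeasure = ∫ z, g z ∂diskMeasure := by
  have h := ((rotation a).measurePreserving.restrict_preimage_emb
    (rotation a).toHomeomorph.measurableEmbedding (ball 0 1))
  have hpre : (rotation a) ⁻¹' ball 0 1 = ball (0:ℂ) 1 := by
    ext z
    simp only [Set.mem_preimage, mem_ball_zero_iff, LinearIsometryEquiv.norm_map]
  rw [hpre] at h
  have := h.integral_comp (rotation a).toHomeomorph.measurableEmbedding g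
  simp only [diskMeasure, integral_smul_measure]
  congr 1

/-- Rotation invariance of the measure gives I = χI for the integral I, and χ ≠ 1. -/
theorem integral_eq_zero_of_rotation {g : ℂ → ℂ} {a : Circle} {χ : ℂ} (hχ : χ ≠ 1)
    (hg : ∀ z ∈ ball (0:ℂ) 1, g (a * z) = χ * g z) : ∫ z, g z ∂diskMeasure = 0 := by
  have h : ∫ z, g z ∂diskMeasure = χ * ∫ z, g z ∂diskMeasure := by
    rw [← integral_const_mul, ← integral_diskMeasure_rotation a]
    apply integral_congr_ae
    filter_upwards [ae_mem_ball] with z hz using hg z hz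
  have h2 : (1 - χ) * ∫ z, g z ∂diskMeasure = 0 := by
    rw [sub_mul, ← h]; ring
  exact (mul_eq_zero.1 h2).resolve_left (sub_ne_zero.2 hχ.symm)

/-- For `m ≠ 0` some element of the circle has `m`-th power different from `1`. -/
theorem exists_circle_zpow_ne_one {m : ℤ} (hm : m ≠ 0) : ∃ a : Circle, (a : ℂ) ^ m ≠ 1 := by
  refine ⟨Circle.exp (Real.pi / m), ?_⟩
  have hm' : (m : ℂ) ≠ 0 := by exact_mod_cast hm
  rw [Circle.coe_exp, ← Complex.exp_int_mul]
  have : (m : ℂ) * (((Real.pi / m : ℝ) : ℂ) * Complex.I) = Real.pi * Complex.I := by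
    push_cast
    field_simp
  rw [this, Complex.exp_pi_mul_I]
  norm_num

theorem integral_norm_pow (n : ℕ) :
    ∫ z, (‖z‖ : ℂ) ^ n ∂diskMeasure = 2 / (n + 2) := by
  -- The interval is (−1, 1) rather than (0, 1) so that the radial profile agrees with the indicator
  -- of the ball at the origin too.
  have h := integral_fun_norm_addHaar (volume : Measure ℂ)
    (fun r => (Set.Ioo (-1:ℝ) 1).indicator (fun r : ℝ => (r : ℂ) ^ n) r)
  have h1 : ∀ z : ℂ, (Set.Ioo (-1:ℝ) 1).indicator (fun r : ℝ => (r : ℂ) ^ n) ‖z‖ =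
      (ball (0:ℂ) 1).indicator (fun z => (‖z‖ : ℂ) ^ n) z := by
    intro z
    by_cases hz : ‖z‖ < 1
    · rw [Set.indicator_of_mem, Set.indicator_of_mem (by simpa using hz)]
      exact ⟨by linarith [norm_nonneg z], hz⟩
    · rw [Set.indicator_of_notMem (fun h => hz h.2),
        Set.indicator_of_notMem (by simpa using hz)]
  have h2 : ∫ y in Set.Ioi (0:ℝ), y ^ (Module.finrank ℝ ℂ - 1) •
      (Set.Ioo (-1:ℝ) 1).indicator (fun r : ℝ => (r : ℂ) ^ n) y = 1 / (n + 2) := by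
    have : ∀ y : ℝ, y ^ (Module.finrank ℝ ℂ - 1) •
      (Set.Ioo (-1:ℝ) 1).indicator (fun r : ℝ => (r : ℂ) ^ n) y =
      (Set.Ioo (-1:ℝ) 1).indicator (fun r : ℝ => ((r ^ (n + 1) : ℝ) : ℂ)) y := by
      intro y
      by_cases hy : y ∈ Set.Ioo (-1:ℝ) 1
      · simp [hy, Complex.finrank_real_complex, pow_succ, mul_comm]
      · simp [hy]
    simp only [this]
    rw [setIntegral_indicator measurableSet_Ioo]
    have hs : Set.Ioi (0:ℝ) ∩ Set.Ioo (-1) 1 = Set.Ioo 0 1 := by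
      ext x
      simp only [Set.mem_inter_iff, Set.mem_Ioi, Set.mem_Ioo]
      constructor
      · rintro ⟨h, -, h'⟩; exact ⟨h, h'⟩
      · rintro ⟨h, h'⟩; exact ⟨h, by linarith, h'⟩
    rw [hs, ← integral_Ioc_eq_integral_Ioo, ← intervalIntegral.integral_of_le zero_le_one,
      intervalIntegral.integral_ofReal, integral_pow]
    push_cast
    simp
    ring
  rw [h2] at h
  simp only [h1] at h
  rw [integral_indicator measurableSet_ball] at h
  rw [diskMeasure, integral_smul_measure, h, Measure.real, Complex.volume_ball,
    Complex.finrank_real_complex, ENNReal.toReal_ofReal (by positivity)]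
  have : (Real.pi : ℂ) ≠ 0 := by exact_mod_cast Real.pi_ne_zero
  simp
  field_simp

theorem memLp_mul_norm_pow {h : ℂ → ℂ} (hh : MemLp h ∞ diskMeasure) (n : ℕ) :
    MemLp (fun z => h z * (‖z‖ : ℂ) ^ n) ∞ diskMeasure := by
  refine hh.of_le (hh.1.mul (by fun_prop : Continuous _).aestronglyMeasurable) ?_
  filter_upwards [ae_mem_ball] with z hz
  rw [norm_mul]
  apply mul_le_of_le_one_right (norm_nonneg _)
  simp only [norm_pow, Complex.norm_real, norm_norm]
  exact pow_le_one₀ (norm_nonneg _) (mem_ball_zero_iff.1 hz).le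

/-- A bounded radial function all of whose radial moments vanish is zero. -/
theorem ae_eq_zero_of_radial_moments {h : ℂ → ℂ} (hrad : IsRadial h)
    (hh : MemLp h ∞ diskMeasure) (hm : ∀ n : ℕ, ∫ z, h z * (‖z‖ : ℂ) ^ (2 * n) ∂diskMeasure = 0) :
    h =ᵐ[diskMeasure] 0 := by
  have hI : Integrable h diskMeasure := hh.integrable le_top
  -- Rotation kills the terms with i ≠ j, and those with i = j are the assumed moments. Thus h
  -- annihilates all polynomials in z and its conjugate, which are dense in C of the closed disk by
  -- Stone–Weierstrass.
  have hmon : ∀ i j : ℕ, ∫ z, h z * (z ^ i * (starRingEnd ℂ) z ^ j) ∂diskMeasure = 0 := by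
    intro i j
    by_cases hij : i = j
    · subst hij
      rw [← hm i]
      congr 1 with z
      rw [← mul_pow, Complex.mul_conj, pow_mul, Complex.normSq_eq_norm_sq]
      push_cast
      rfl
    · obtain ⟨a, ha⟩ := exists_circle_zpow_ne_one (m := (i : ℤ) - j) (by omega)
      refine integral_eq_zero_of_rotation (a := a) ha fun z hz => ?_
      have h1 : h (a * z) = h z := by
        exact hrad _ (by simpa [Circle.norm_coe] using hz) _ hz (by simp [Circle.norm_coe])
      rw [h1, zpow_sub₀ (by simp), map_mul, ← Circle.coe_inv_eq_conj]
      simp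
      ring
  let s : Set ℂ := closedBall 0 1
  have : CompactSpace s := isCompact_iff_compactSpace.1 (isCompact_closedBall _ _)
  classical
  -- A measurable map to the compact disk; the value 0 off the disk is irrelevant, since the measure
  -- lives on the disk.
  let t : ℂ → s := fun z => ⟨if z ∈ s then z else 0, by split_ifs with hz; exacts [hz, by simp [s]]⟩
  have ht : Measurable t :=
    (Measurable.ite measurableSet_closedBall measurable_id measurable_const).subtype_mk
  have htz : ∀ z ∈ ball (0:ℂ) 1, (t z : ℂ) = z := fun z hz => by
    simp [t, s, (mem_ball_zero_iff.1 hz).le]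
  let Λ := integralFunctional ht hI
  have key : ∀ g : C(s, ℂ), Λ g = 0 := by
    let M : Set C(s, ℂ) :=
      {f | ∃ i j : ℕ, ∀ x : s, f x = (x : ℂ) ^ i * (starRingEnd ℂ) (x : ℂ) ^ j}
    have hM : ∀ f ∈ Submodule.span ℂ M, Λ f = 0 := by
      intro f hf
      induction hf using Submodule.span_induction with
      | mem f hf =>
        obtain ⟨i, j, hf⟩ := hf
        rw [integralFunctional_apply, ← hmon i j]
        apply integral_congr_ae
        filter_upwards [ae_mem_ball] with z hz
        rw [hf, htz z hz]
      | zero => simp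
      | add f g _ _ hf hg => rw [map_add, hf, hg, add_zero]
      | smul c f _ hf => rw [map_smul, hf, smul_zero]
    have hpoly : ∀ f ∈ (polynomialFunctions s).starClosure, f ∈ Submodule.span ℂ M := by
      intro f hf
      rw [polynomialFunctions.starClosure_eq_adjoin_X, ← StarSubalgebra.mem_toSubalgebra,
        StarAlgebra.adjoin_toSubalgebra] at hf
      -- The induction is strengthened to "multiplication by f preserves the span", which makes the
      -- product case immediate; f itself is recovered at v = 1.
      have hmul : ∀ v ∈ Submodule.span ℂ M, f * v ∈ Submodule.span ℂ M := by
        induction hf using Algebra.adjoin_induction with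
        | mem f hf =>
          intro v hv
          induction hv using Submodule.span_induction with
          | mem v hv =>
            obtain ⟨i, j, hv⟩ := hv
            rcases hf with hf | hf
            · rw [Set.mem_singleton_iff] at hf
              refine Submodule.subset_span ⟨i + 1, j, fun x => ?_⟩
              simp [hf, hv]
              ring
            · rw [Set.mem_star, Set.mem_singleton_iff, star_eq_iff_star_eq] at hf
              refine Submodule.subset_span ⟨i, j + 1, fun x => ?_⟩
              simp [← hf, hv]
              ring
          | zero => simp
          | add v w _ _ hv hw => rw [mul_add]; exact add_mem hv hw
          | smul c v _ hv => rw [mul_smul_comm]; exact Submodule.smul_mem _ _ hv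
        | algebraMap c =>
          intro v hv
          rw [← Algebra.smul_def]
          exact Submodule.smul_mem _ _ hv
        | add f g _ _ hf hg =>
          intro v hv
          rw [add_mul]
          exact add_mem (hf v hv) (hg v hv)
        | mul f g _ _ hf hg =>
          intro v hv
          rw [mul_assoc]
          exact hf _ (hg v hv)
      rw [← mul_one f]
      exact hmul 1 (Submodule.subset_span ⟨0, 0, by simp⟩)
    intro g
    have hg : g ∈ (polynomialFunctions s).starClosure.topologicalClosure := by
      rw [polynomialFunctions.starClosure_topologicalClosure]
      trivial
    exact closure_minimal (fun f hf => hM f (hpoly f hf))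
      (isClosed_eq Λ.continuous continuous_const) hg
  refine ae_eq_zero_of_integral_contDiff_smul_eq_zero hI.locallyIntegrable fun g hg _ => ?_
  have hgc : Continuous fun z : ℂ => (g z : ℂ) := Complex.continuous_ofReal.comp hg.continuous
  rw [← key ⟨fun x : s => (g x : ℂ), hgc.comp continuous_subtype_val⟩, integralFunctional_apply]
  apply integral_congr_ae
  filter_upwards [ae_mem_ball] with z hz
  simp [htz z hz, mul_comm]

/-! ### Harmonic monomials -/

/-- The harmonic monomials `r ^ |k| * exp (i k θ)`. -/
noncomputable def harmonicMonomial (k : ℤ) (z : ℂ) : ℂ :=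
  if 0 ≤ k then z ^ k.natAbs else (starRingEnd ℂ) z ^ k.natAbs

theorem harmonicMonomial_eq (k : ℤ) (z : ℂ) :
    harmonicMonomial k z = (‖z‖ : ℂ) ^ k.natAbs * Complex.exp (Complex.I * k * Complex.arg z) := by
  have h1 : z = ‖z‖ * Complex.exp (Complex.arg z * Complex.I) :=
    (Complex.norm_mul_exp_arg_mul_I z).symm
  have h2 : (starRingEnd ℂ) z = ‖z‖ * Complex.exp (-(Complex.arg z * Complex.I)) := by
    conv_lhs => rw [h1]
    rw [map_mul, ← Complex.exp_conj]
    simp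
  unfold harmonicMonomial
  split_ifs with hk
  · conv_lhs => rw [h1]
    rw [mul_pow, ← Complex.exp_nat_mul]
    congr 2
    have : ((k.natAbs : ℕ) : ℂ) = k := by
      rw [← Int.cast_natCast, Int.natAbs_of_nonneg hk]
    rw [this]
    ring
  · rw [h2, mul_pow, ← Complex.exp_nat_mul]
    congr 2
    have : ((k.natAbs : ℕ) : ℂ) = -k := by
      rw [← Int.cast_natCast, Int.ofNat_natAbs_of_nonpos (by omega)]
      simp
    rw [this]
    ring

theorem conj_harmonicMonomial (k : ℤ) (z : ℂ) :
    (starRingEnd ℂ) (harmonicMonomial k z) = harmonicMonomial (-k) z := by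
  rw [harmonicMonomial_eq, harmonicMonomial_eq, map_mul, ← Complex.exp_conj]
  simp

theorem harmonicMonomial_mul_neg (k : ℤ) (z : ℂ) :
    harmonicMonomial k z * harmonicMonomial (-k) z = (‖z‖ : ℂ) ^ (2 * k.natAbs) := by
  rw [harmonicMonomial_eq, harmonicMonomial_eq, mul_mul_mul_comm, ← Complex.exp_add]
  simp only [Int.natAbs_neg, Int.cast_neg]
  rw [← pow_add, ← two_mul]
  simp

theorem harmonicMonomial_rotation (k : ℤ) (a : Circle) (z : ℂ) :
    harmonicMonomial k (a * z) = (a : ℂ) ^ k * harmonicMonomial k z := by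
  unfold harmonicMonomial
  split_ifs with hk
  · rw [mul_pow, ← zpow_natCast (a : ℂ), Int.natAbs_of_nonneg hk]
  · rw [map_mul, mul_pow, ← Circle.coe_inv_eq_conj, Circle.coe_inv, inv_pow,
      ← zpow_natCast (a : ℂ), ← zpow_neg, Int.ofNat_natAbs_of_nonpos (by omega), neg_neg]

theorem continuous_harmonicMonomial (k : ℤ) : Continuous (harmonicMonomial k) := by
  unfold harmonicMonomial
  split_ifs
  · fun_prop
  · exact Complex.continuous_conj.pow _

theorem harmonicOnNhd_conj {u : ℂ → ℂ} {s : Set ℂ} (hu : HarmonicOnNhd u s) :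
    HarmonicOnNhd (fun z => (starRingEnd ℂ) (u z)) s :=
  hu.comp_CLM (Complex.conjCLE : ℂ →L[ℝ] ℂ)

theorem harmonicOnNhd_harmonicMonomial (k : ℤ) (s : Set ℂ) :
    HarmonicOnNhd (harmonicMonomial k) s := by
  have h : ∀ n : ℕ, HarmonicOnNhd (fun z : ℂ => z ^ n) s := fun n z _ =>
    (by fun_prop : AnalyticAt ℂ (fun z : ℂ => z ^ n) z).harmonicAt
  by_cases hk : 0 ≤ k
  · convert h k.natAbs using 2 with z
    simp [harmonicMonomial, hk]
  · convert harmonicOnNhd_conj (h k.natAbs) using 2 with z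
    simp [harmonicMonomial, hk]

theorem norm_harmonicMonomial (k : ℤ) (z : ℂ) : ‖harmonicMonomial k z‖ = ‖z‖ ^ k.natAbs := by
  unfold harmonicMonomial
  split_ifs <;> simp

theorem norm_harmonicMonomial_le_one (k : ℤ) {z : ℂ} (hz : z ∈ ball (0:ℂ) 1) :
    ‖harmonicMonomial k z‖ ≤ 1 := by
  rw [norm_harmonicMonomial]
  exact pow_le_one₀ (norm_nonneg _) (mem_ball_zero_iff.1 hz).le

theorem memLp_harmonicMonomial (k : ℤ) : MemLp (harmonicMonomial k) ∞ diskMeasure :=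
  memLp_top_of_bound (continuous_harmonicMonomial k).aestronglyMeasurable 1
    (by filter_upwards [ae_mem_ball] with z hz using norm_harmonicMonomial_le_one k hz)

theorem IsRadial.conj {h : ℂ → ℂ} (hh : IsRadial h) : IsRadial fun z => (starRingEnd ℂ) (h z) :=
  fun z hz w hw e => congrArg (starRingEnd ℂ) (hh z hz w hw e)

theorem memLp_conj {h : ℂ → ℂ} {p : ℝ≥0∞} (hh : MemLp h p diskMeasure) :
    MemLp (fun z => (starRingEnd ℂ) (h z)) p diskMeasure := hh.star

theorem MemLp.mul_harmonicMonomial {h : ℂ → ℂ} (hh : MemLp h ∞ diskMeasure) (k : ℤ) :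
    MemLp (fun z => h z * harmonicMonomial k z) ∞ diskMeasure :=
  (memLp_harmonicMonomial k).mul hh

/-! ### Pairing harmonic functions with radial multiples of monomials -/

theorem setIntegral_harmonicMonomial_mul {h : ℂ → ℂ} (hrad : IsRadial h) {R : ℝ}
    {j k : ℤ} (hjk : j + k ≠ 0) :
    ∫ z in ball 0 R, harmonicMonomial j z * (h z * harmonicMonomial k z) ∂diskMeasure = 0 := by
  rw [← integral_indicator measurableSet_ball]
  obtain ⟨a, ha⟩ := exists_circle_zpow_ne_one hjk
  refine integral_eq_zero_of_rotation (a := a) ha fun z hz => ?_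
  have h1 : h (a * z) = h z :=
    hrad _ (by simpa [Circle.norm_coe] using hz) _ hz (by simp [Circle.norm_coe])
  by_cases hR : z ∈ ball (0:ℂ) R
  · rw [Set.indicator_of_mem (by simpa [Circle.norm_coe] using hR), Set.indicator_of_mem hR,
      harmonicMonomial_rotation, harmonicMonomial_rotation, h1, zpow_add₀ (by simp)]
    ring
  · rw [Set.indicator_of_notMem (by simpa [Circle.norm_coe] using hR), Set.indicator_of_notMem hR,
      mul_zero]

theorem integrableOn_mul_of_continuousOn {F h : ℂ → ℂ} (hF : ContinuousOn F (ball 0 1))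
    (hh : MemLp h ∞ diskMeasure) {R : ℝ} (hR : R < 1) :
    IntegrableOn (fun z => F z * h z) (ball 0 R) diskMeasure := by
  obtain ⟨C, hC⟩ := (isCompact_closedBall (0:ℂ) R).exists_bound_of_continuousOn
    (hF.mono (closedBall_subset_ball hR))
  refine Integrable.bdd_mul (c := C) (hh.integrable le_top).integrableOn
    ((hF.mono (ball_subset_ball hR.le)).aestronglyMeasurable measurableSet_ball) ?_
  filter_upwards [ae_restrict_mem measurableSet_ball] with z hz
  exact hC z (ball_subset_closedBall hz)

/-- Integrating the Taylor series term by term, only the index −k survives the angular integration.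
The constant c depends on neither h nor R: different radial weights can be compared, and R can tend
to 1. Radii R < 1 are needed because the series need not converge on the unit circle. -/
theorem exists_coeff_of_analyticOnNhd {F : ℂ → ℂ} (hF : AnalyticOnNhd ℂ F (ball 0 1)) (k : ℤ) :
    ∃ c : ℂ, ∀ h : ℂ → ℂ, IsRadial h → MemLp h ∞ diskMeasure → ∀ R ∈ Set.Ioo (0:ℝ) 1,
      ∫ z in ball 0 R, F z * (h z * harmonicMonomial k z) ∂diskMeasure =
        c * ∫ z in ball 0 R, h z * (‖z‖ : ℂ) ^ (2 * k.natAbs) ∂diskMeasure := by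
  set a : ℕ → ℂ := fun n => ((n.factorial : ℂ))⁻¹ * iteratedDeriv n F 0 with ha
  have hsum : ∀ z ∈ ball (0:ℂ) 1, HasSum (fun n => a n * harmonicMonomial n z) (F z) := by
    intro z hz
    have := Complex.hasSum_taylorSeries_on_ball hF.differentiableOn hz
    refine this.congr_fun fun n => ?_
    simp [ha, harmonicMonomial]
    ring
  have key : ∀ h : ℂ → ℂ, IsRadial h → MemLp h ∞ diskMeasure → ∀ R ∈ Set.Ioo (0:ℝ) 1,
      HasSum (fun n : ℕ => a n * ∫ z in ball 0 R,
          harmonicMonomial n z * (h z * harmonicMonomial k z) ∂diskMeasure)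
        (∫ z in ball 0 R, F z * (h z * harmonicMonomial k z) ∂diskMeasure) := by
    intro h hrad hh R hR
    have hI : ∀ n : ℕ, IntegrableOn (fun z => harmonicMonomial n z *
        (h z * harmonicMonomial k z)) (ball 0 R) diskMeasure := fun n =>
      integrableOn_mul_of_continuousOn (continuous_harmonicMonomial n).continuousOn
        (MemLp.mul_harmonicMonomial hh k) hR.2
    have hG : Integrable (fun z => h z * harmonicMonomial k z) diskMeasure :=
      (MemLp.mul_harmonicMonomial hh k).integrable le_top
    have hs := hasSum_integral_of_summable_integral_norm
      (F := fun (n : ℕ) z => a n * (harmonicMonomial n z * (h z * harmonicMonomial k z)))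
      (μ := diskMeasure.restrict (ball 0 R)) (fun n => (hI n).const_mul _) ?_
    · simp only [integral_const_mul] at hs
      have he : ∫ z in ball 0 R, F z * (h z * harmonicMonomial k z) ∂diskMeasure =
          ∫ z in ball 0 R, ∑' n : ℕ, a n *
            (harmonicMonomial n z * (h z * harmonicMonomial k z)) ∂diskMeasure := ?_
      · rwa [he]
      apply setIntegral_congr_fun measurableSet_ball
      intro z hz
      have h1 := (hsum z (ball_subset_ball hR.2.le hz)).mul_right (h z * harmonicMonomial k z)
      simp only
      rw [← h1.tsum_eq]
      simp only [mul_assoc]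
    -- The majorant of the terms on |z| < R is the Taylor series at the point R, which converges
    -- absolutely since R < 1.
    · have hs1 : Summable fun n => ‖a n * harmonicMonomial n (R : ℂ)‖ :=
        (hsum R (by simp [abs_of_pos hR.1, hR.2])).summable.norm
      refine Summable.of_nonneg_of_le (fun n => integral_nonneg fun z => norm_nonneg _)
        (fun n => ?_) (hs1.mul_right (∫ z in ball 0 R, ‖h z * harmonicMonomial k z‖ ∂diskMeasure))
      rw [← integral_const_mul]
      refine integral_mono_ae ((hI n).const_mul _).norm (hG.integrableOn.norm.const_mul _) ?_
      filter_upwards [ae_restrict_mem measurableSet_ball] with z hz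
      rw [← mul_assoc, norm_mul]
      refine mul_le_mul_of_nonneg_right ?_ (norm_nonneg _)
      rw [norm_mul (a n), norm_mul (a n), norm_harmonicMonomial, norm_harmonicMonomial]
      refine mul_le_mul_of_nonneg_left (pow_le_pow_left₀ (norm_nonneg _) ?_ _) (norm_nonneg _)
      simpa [abs_of_pos hR.1] using (mem_ball_zero_iff.1 hz).le
  by_cases hk : k ≤ 0
  · refine ⟨a k.natAbs, fun h hrad hh R hR => ?_⟩
    have hkn : ((k.natAbs : ℕ) : ℤ) = -k := Int.ofNat_natAbs_of_nonpos hk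
    refine (key h hrad hh R hR).unique ?_
    convert hasSum_single k.natAbs ?_ using 1
    · congr 2
      ext z
      rw [← harmonicMonomial_mul_neg, hkn]
      ring
    · intro n hn
      rw [setIntegral_harmonicMonomial_mul hrad (by omega), mul_zero]
  · refine ⟨0, fun h hrad hh R hR => ?_⟩
    refine (key h hrad hh R hR).unique ?_
    convert hasSum_zero using 2 with n
    · rw [setIntegral_harmonicMonomial_mul hrad (by omega), mul_zero]
    · simp

/-- With Re u = Re F and Im u = Re G for holomorphic F and G, u = Re F + i Re G = (F + iG)/2 +
conj((F − iG)/2). -/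
theorem exists_analytic_add_conj {u : ℂ → ℂ} (hu : HarmonicOnNhd u (ball 0 1)) :
    ∃ A B : ℂ → ℂ, AnalyticOnNhd ℂ A (ball 0 1) ∧ AnalyticOnNhd ℂ B (ball 0 1) ∧
      ∀ z ∈ ball (0:ℂ) 1, u z = A z + (starRingEnd ℂ) (B z) := by
  obtain ⟨F, hF, hFu⟩ := (hu.comp_CLM Complex.reCLM).exists_analyticOnNhd_ball_re_eq
  obtain ⟨G, hG, hGu⟩ := (hu.comp_CLM Complex.imCLM).exists_analyticOnNhd_ball_re_eq
  refine ⟨fun z => ((2⁻¹ : ℝ) : ℂ) * (F z + Complex.I * G z),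
    fun z => ((2⁻¹ : ℝ) : ℂ) * (F z - Complex.I * G z),
    fun z hz => ?_, fun z hz => ?_, fun z hz => ?_⟩
  · have := hF z hz
    have := hG z hz
    fun_prop
  · have := hF z hz
    have := hG z hz
    fun_prop
  · have h1 : (F z).re = (u z).re := hFu hz
    have h2 : (G z).re = (u z).im := hGu hz
    apply Complex.ext
    · simp only [map_mul, map_sub, Complex.conj_ofReal, Complex.conj_I, Complex.add_re,
        Complex.ofReal_re, Complex.ofReal_im, Complex.sub_re, Complex.mul_re, Complex.conj_re,
        Complex.conj_im, Complex.I_re, Complex.I_im, Complex.neg_re, Complex.neg_im, ← h1]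
      ring
    · simp only [map_mul, map_sub, Complex.conj_ofReal, Complex.conj_I, Complex.add_im,
        Complex.ofReal_re, Complex.ofReal_im, Complex.sub_im, Complex.mul_im, Complex.conj_re,
        Complex.conj_im, Complex.I_re, Complex.I_im, Complex.neg_re, Complex.neg_im, ← h2]
      ring

theorem exists_coeff_of_harmonicOnNhd {u : ℂ → ℂ} (hu : HarmonicOnNhd u (ball 0 1)) (k : ℤ) :
    ∃ c : ℂ, ∀ h : ℂ → ℂ, IsRadial h → MemLp h ∞ diskMeasure → ∀ R ∈ Set.Ioo (0:ℝ) 1,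
      ∫ z in ball 0 R, u z * (h z * harmonicMonomial k z) ∂diskMeasure =
        c * ∫ z in ball 0 R, h z * (‖z‖ : ℂ) ^ (2 * k.natAbs) ∂diskMeasure := by
  obtain ⟨A, B, hA, hB, huAB⟩ := exists_analytic_add_conj hu
  obtain ⟨c, hc⟩ := exists_coeff_of_analyticOnNhd hA k
  obtain ⟨d, hd⟩ := exists_coeff_of_analyticOnNhd hB (-k)
  refine ⟨c + (starRingEnd ℂ) d, fun h hrad hh R hR => ?_⟩
  -- The antiholomorphic part reduces to the holomorphic case by conjugation, which replaces h by
  -- its conjugate and k by −k.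
  have hB' : ∫ z in ball 0 R, (starRingEnd ℂ) (B z) * (h z * harmonicMonomial k z) ∂diskMeasure =
      (starRingEnd ℂ) d * ∫ z in ball 0 R, h z * (‖z‖ : ℂ) ^ (2 * k.natAbs) ∂diskMeasure := by
    have h1 := congrArg (starRingEnd ℂ) (hd _ hrad.conj (memLp_conj hh) R hR)
    rw [map_mul, ← integral_conj, ← integral_conj] at h1
    simpa [conj_harmonicMonomial] using h1
  rw [add_mul, ← hc h hrad hh R hR, ← hB', ← integral_add]
  · apply setIntegral_congr_fun measurableSet_ball
    intro z hz
    simp only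
    rw [huAB z (ball_subset_ball hR.2.le hz), add_mul]
  · exact integrableOn_mul_of_continuousOn hA.continuousOn (MemLp.mul_harmonicMonomial hh k) hR.2
  · exact integrableOn_mul_of_continuousOn (Complex.continuous_conj.comp_continuousOn
      hB.continuousOn) (MemLp.mul_harmonicMonomial hh k) hR.2

/-- On each smaller disk the integral is c times the truncated moment of h, with one c for all
radii; letting the radius tend to 1 gives c times the full moment, which is zero. -/
theorem integral_harmonic_mul_radial_eq_zero {u : ℂ → ℂ} (hu : HarmonicOnNhd u (ball 0 1))
    (hui : Integrable u diskMeasure) {h : ℂ → ℂ} (hrad : IsRadial h) (hh : MemLp h ∞ diskMeasure)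
    {k : ℤ} (hk : ∫ z, h z * (‖z‖ : ℂ) ^ (2 * k.natAbs) ∂diskMeasure = 0) :
    ∫ z, u z * (h z * harmonicMonomial k z) ∂diskMeasure = 0 := by
  obtain ⟨c, hc⟩ := exists_coeff_of_harmonicOnNhd hu k
  set R : ℕ → ℝ := fun n => 1 - 1 / (n + 2) with hRdef
  have hR : ∀ n, R n ∈ Set.Ioo (0:ℝ) 1 := by
    intro n
    constructor
    · rw [hRdef, sub_pos, div_lt_one (by positivity)]
      linarith [(Nat.cast_nonneg n : (0:ℝ) ≤ n)]
    · have : (0:ℝ) < 1 / (n + 2) := by positivity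
      simp only [hRdef]; linarith
  have hmono : Monotone fun n => ball (0:ℂ) (R n) := by
    intro m n hmn
    apply ball_subset_ball
    simp only [hRdef]
    have : (m:ℝ) ≤ n := by exact_mod_cast hmn
    gcongr
  have hun : ⋃ n, ball (0:ℂ) (R n) = ball 0 1 := by
    apply Set.Subset.antisymm (Set.iUnion_subset fun n => ball_subset_ball (hR n).2.le)
    intro z hz
    have hlim : Tendsto R atTop (𝓝 1) := by
      have := (tendsto_one_div_add_atTop_nhds_zero_nat (𝕜 := ℝ)).comp (tendsto_add_atTop_nat 1)
      have h2 := this.const_sub 1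
      rw [sub_zero] at h2
      refine h2.congr fun n => ?_
      simp [hRdef]
      ring
    obtain ⟨n, hn⟩ := (hlim.eventually (lt_mem_nhds (mem_ball_zero_iff.1 hz))).exists
    exact Set.mem_iUnion.2 ⟨n, by simpa using hn⟩
  have hrestr : diskMeasure.restrict (ball 0 1) = diskMeasure :=
    Measure.restrict_eq_self_of_ae_mem ae_mem_ball
  have hlim : ∀ f : ℂ → ℂ, Integrable f diskMeasure →
      Tendsto (fun n => ∫ z in ball 0 (R n), f z ∂diskMeasure) atTop
        (𝓝 (∫ z, f z ∂diskMeasure)) := by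
    intro f hf
    have := tendsto_setIntegral_of_monotone (fun n => measurableSet_ball) hmono
      (hf.integrableOn (s := ⋃ n, ball (0:ℂ) (R n)))
    rwa [hun, hrestr] at this
  have hhe := MemLp.mul_harmonicMonomial hh k
  have l1 := hlim (fun z => u z * (h z * harmonicMonomial k z)) (hui.mul_of_top_left hhe)
  have l2 := (hlim _ ((memLp_mul_norm_pow hh (2 * k.natAbs)).integrable le_top)).const_mul c
  simp only [hc h hrad hh _ (hR _)] at l1
  rw [tendsto_nhds_unique l1 l2, hk, mul_zero]

/-- The eigenvalues of the Toeplitz operator with radial symbol `ψ`. -/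
noncomputable def radialEigenvalue (ψ : ℂ → ℂ) (n : ℕ) : ℂ :=
  (n + 1) * ∫ z, ψ z * (‖z‖ : ℂ) ^ (2 * n) ∂diskMeasure

theorem IsRadial.sub_const {ψ : ℂ → ℂ} (h : IsRadial ψ) (c : ℂ) : IsRadial fun z => ψ z - c :=
  fun z hz w hw e => congrArg (· - c) (h z hz w hw e)

theorem memLp_sub_const {ψ : ℂ → ℂ} (hψ : MemLp ψ ∞ diskMeasure) (c : ℂ) :
    MemLp (fun z => ψ z - c) ∞ diskMeasure := hψ.sub (memLp_const c)

theorem integral_sub_const_mul_norm_pow {ψ : ℂ → ℂ} (hψ : MemLp ψ ∞ diskMeasure) (c : ℂ) (n : ℕ) :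
    ∫ z, (ψ z - c) * (‖z‖ : ℂ) ^ (2 * n) ∂diskMeasure =
      (radialEigenvalue ψ n - c) / (n + 1) := by
  have h0 : (n : ℂ) + 1 ≠ 0 := Nat.cast_add_one_ne_zero n
  have h1 := (memLp_mul_norm_pow hψ (2 * n)).integrable le_top
  have h2 := (memLp_mul_norm_pow (memLp_const c) (2 * n)).integrable le_top
  simp only [sub_mul]
  rw [integral_sub h1 h2, integral_const_mul, integral_norm_pow, radialEigenvalue]
  push_cast
  have : (2 : ℂ) * n + 2 ≠ 0 := by
    rw [← mul_add_one]; exact mul_ne_zero two_ne_zero h0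
  field_simp

/-- The constant λ(|k|) is exactly the one for which ψ − λ(|k|) has vanishing moment of order 2|k|,
so the preceding vanishing result applies to the difference. -/
theorem integral_harmonic_mul_radial {u : ℂ → ℂ} (hu : HarmonicOnNhd u (ball 0 1))
    (hui : Integrable u diskMeasure) {ψ : ℂ → ℂ} (hrad : IsRadial ψ) (hψ : MemLp ψ ∞ diskMeasure)
    (k : ℤ) :
    ∫ z, u z * (ψ z * harmonicMonomial k z) ∂diskMeasure =
      radialEigenvalue ψ k.natAbs * ∫ z, u z * harmonicMonomial k z ∂diskMeasure := by
  have h := integral_harmonic_mul_radial_eq_zero hu hui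
    (hrad.sub_const (radialEigenvalue ψ k.natAbs)) (memLp_sub_const hψ _) (k := k)
    (by rw [integral_sub_const_mul_norm_pow hψ]; simp)
  have h1 : Integrable (fun z => u z * (ψ z * harmonicMonomial k z)) diskMeasure :=
    hui.mul_of_top_left (MemLp.mul_harmonicMonomial hψ k)
  have h2 : Integrable (fun z => u z * harmonicMonomial k z) diskMeasure :=
    hui.mul_of_top_left (memLp_harmonicMonomial k)
  rw [← integral_const_mul, ← sub_eq_zero, ← integral_sub h1 (h2.const_mul _), ← h]
  congr 1 with z
  ring

/-! ### Matrix coefficients of Toeplitz operators -/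

/-- The projection may be dropped because v already lies in its range. -/
theorem inner_toeplitz (f : ℂ → ℂ) (hf : MemLp f ∞ diskMeasure) (v u : harmonicBergman) :
    inner ℂ v (toeplitz f hf u) = ∫ z, (starRingEnd ℂ) ((v : Lp ℂ 2 diskMeasure) z) *
      (f z * (u : Lp ℂ 2 diskMeasure) z) ∂diskMeasure := by
  have hm : MemLp (fun z => f z * (u : Lp ℂ 2 diskMeasure) z) 2 diskMeasure :=
    (Lp.memLp (u : Lp ℂ 2 diskMeasure)).mul hf
  rw [toeplitz_apply f hf u (hm.toLp _) hm.coeFn_toLp,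
    Submodule.inner_orthogonalProjectionOnto_eq_of_mem_left, L2.inner_def]
  apply integral_congr_ae
  filter_upwards [hm.coeFn_toLp] with z hz
  rw [hz, RCLike.inner_apply]
  ring

theorem memLp_two_harmonicMonomial (k : ℤ) : MemLp (harmonicMonomial k) 2 diskMeasure :=
  (memLp_harmonicMonomial k).mono_exponent le_top

/-- The harmonic monomials as elements of the harmonic Bergman space. -/
noncomputable def monomialVec (k : ℤ) : harmonicBergman :=
  ⟨(memLp_two_harmonicMonomial k).toLp _, harmonicMonomial k,
    harmonicOnNhd_harmonicMonomial k _, (memLp_two_harmonicMonomial k).coeFn_toLp⟩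

theorem coeFn_monomialVec (k : ℤ) :
    (monomialVec k : Lp ℂ 2 diskMeasure) =ᵐ[diskMeasure] harmonicMonomial k :=
  (memLp_two_harmonicMonomial k).coeFn_toLp

theorem integral_mem_mul_radial (u : harmonicBergman) {ψ : ℂ → ℂ} (hrad : IsRadial ψ)
    (hψ : MemLp ψ ∞ diskMeasure) (k : ℤ) :
    ∫ z, (u : Lp ℂ 2 diskMeasure) z * (ψ z * harmonicMonomial k z) ∂diskMeasure =
      radialEigenvalue ψ k.natAbs *
        ∫ z, (u : Lp ℂ 2 diskMeasure) z * harmonicMonomial k z ∂diskMeasure := by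
  obtain ⟨w, hw, huw⟩ := u.2
  have hi : Integrable w diskMeasure :=
    ((Lp.memLp (u : Lp ℂ 2 diskMeasure)).integrable one_le_two).congr huw
  have h := integral_harmonic_mul_radial hw hi hrad hψ k
  convert h using 1
  · apply integral_congr_ae
    filter_upwards [huw] with z hz
    rw [hz]
  · congr 1
    apply integral_congr_ae
    filter_upwards [huw] with z hz
    rw [hz]

theorem integral_conj_mem_mul_radial (u : harmonicBergman) {ψ : ℂ → ℂ} (hrad : IsRadial ψ)
    (hψ : MemLp ψ ∞ diskMeasure) (k : ℤ) :
    ∫ z, (starRingEnd ℂ) ((u : Lp ℂ 2 diskMeasure) z) * (ψ z * harmonicMonomial k z) ∂diskMeasure =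
      radialEigenvalue ψ k.natAbs *
        ∫ z, (starRingEnd ℂ) ((u : Lp ℂ 2 diskMeasure) z) * harmonicMonomial k z ∂diskMeasure := by
  obtain ⟨w, hw, huw⟩ := u.2
  have hi : Integrable w diskMeasure :=
    ((Lp.memLp (u : Lp ℂ 2 diskMeasure)).integrable one_le_two).congr huw
  have h := integral_harmonic_mul_radial (harmonicOnNhd_conj hw)
    (memLp_one_iff_integrable.1 (memLp_conj (memLp_one_iff_integrable.2 hi))) hrad hψ k
  convert h using 1
  · apply integral_congr_ae
    filter_upwards [huw] with z hz
    rw [hz]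
  · congr 1
    apply integral_congr_ae
    filter_upwards [huw] with z hz
    rw [hz]

theorem inner_smul_right_harmonicBergman (c : ℂ) (v w : harmonicBergman) :
    inner ℂ v (c • w) = c * inner ℂ v w :=
  inner_smul_right (v : Lp ℂ 2 diskMeasure) (w : Lp ℂ 2 diskMeasure) c

theorem toeplitz_radial_monomialVec {ψ : ℂ → ℂ} (hrad : IsRadial ψ) (hψ : MemLp ψ ∞ diskMeasure)
    (k : ℤ) :
    toeplitz ψ hψ (monomialVec k) = radialEigenvalue ψ k.natAbs • monomialVec k := by
  refine ext_inner_left ℂ fun v => ?_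
  rw [inner_toeplitz, inner_smul_right_harmonicBergman, Submodule.coe_inner, L2.inner_def]
  convert integral_conj_mem_mul_radial v hrad hψ k using 1
  · apply integral_congr_ae
    filter_upwards [coeFn_monomialVec k] with z hz
    rw [hz]
  · congr 1
    apply integral_congr_ae
    filter_upwards [coeFn_monomialVec k] with z hz
    rw [hz, RCLike.inner_apply, mul_comm]

/-- Diagonality seen from the left, obtained without adjoints: the conjugate of e_k is e_{−k}, and
|−k| = |k|. -/
theorem inner_monomialVec_toeplitz_radial {ψ : ℂ → ℂ} (hrad : IsRadial ψ)
    (hψ : MemLp ψ ∞ diskMeasure) (k : ℤ) (v : harmonicBergman) :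
    inner ℂ (monomialVec k) (toeplitz ψ hψ v) =
      radialEigenvalue ψ k.natAbs * inner ℂ (monomialVec k) v := by
  rw [inner_toeplitz, Submodule.coe_inner, L2.inner_def]
  convert integral_mem_mul_radial v hrad hψ (-k) using 1
  · apply integral_congr_ae
    filter_upwards [coeFn_monomialVec k] with z hz
    rw [hz, conj_harmonicMonomial]
    ring
  · rw [Int.natAbs_neg]
    congr 1
    apply integral_congr_ae
    filter_upwards [coeFn_monomialVec k] with z hz
    rw [hz, RCLike.inner_apply, conj_harmonicMonomial]

/-- The phases −(k+p), p and k add up to zero, leaving a purely radial integral. -/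
theorem inner_toeplitz_quasihomogeneous (p k : ℤ) {φ : ℂ → ℂ} (hφ : MemLp φ ∞ diskMeasure) :
    inner ℂ (monomialVec (k + p)) (toeplitz (quasihomogeneous p φ)
        (memLp_quasihomogeneous p hφ) (monomialVec k)) =
      ∫ z, φ z * (‖z‖ : ℂ) ^ ((k + p).natAbs + k.natAbs) ∂diskMeasure := by
  rw [inner_toeplitz]
  apply integral_congr_ae
  filter_upwards [coeFn_monomialVec k, coeFn_monomialVec (k + p)] with z h1 h2
  rw [h1, h2, conj_harmonicMonomial, harmonicMonomial_eq, harmonicMonomial_eq, quasihomogeneous,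
    Int.natAbs_neg, pow_add]
  have : Complex.exp (Complex.I * ((-(k + p) : ℤ) : ℂ) * Complex.arg z) *
      (Complex.exp (Complex.I * p * Complex.arg z) * Complex.exp (Complex.I * k * Complex.arg z)) =
      1 := by
    rw [← Complex.exp_add, ← Complex.exp_add, ← Complex.exp_zero]
    congr 1
    push_cast
    ring
  linear_combination (φ z * (‖z‖ : ℂ) ^ (k + p).natAbs * (‖z‖ : ℂ) ^ k.natAbs) * this

theorem eigenvalue_sub_mul_eq_zero_of_commute {p : ℤ} {φ ψ : ℂ → ℂ}
    (hφ : MemLp φ ∞ diskMeasure) (hψrad : IsRadial ψ) (hψ : MemLp ψ ∞ diskMeasure)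
    (hcomm : toeplitz ψ hψ ∘L toeplitz (quasihomogeneous p φ) (memLp_quasihomogeneous p hφ) =
      toeplitz (quasihomogeneous p φ) (memLp_quasihomogeneous p hφ) ∘L toeplitz ψ hψ) (n : ℕ) :
    (∫ z, φ z * (‖z‖ : ℂ) ^ (2 * n + p.natAbs) ∂diskMeasure) *
      (radialEigenvalue ψ (n + p.natAbs) - radialEigenvalue ψ n) = 0 := by
  -- Taking k with the sign of p avoids cancellation: |k + p| = |k| + |p|.
  obtain ⟨k, hk, hkp⟩ : ∃ k : ℤ, k.natAbs = n ∧ (k + p).natAbs = n + p.natAbs := by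
    rcases le_total 0 p with h | h
    · exact ⟨n, by omega, by omega⟩
    · exact ⟨-n, by omega, by omega⟩
  have h := congrArg (fun T => inner ℂ (monomialVec (k + p)) (T (monomialVec k))) hcomm
  simp only [ContinuousLinearMap.comp_apply] at h
  rw [inner_monomialVec_toeplitz_radial hψrad, toeplitz_radial_monomialVec hψrad, map_smul,
    inner_smul_right_harmonicBergman, inner_toeplitz_quasihomogeneous p k hφ, hk, hkp,
    show n + p.natAbs + n = 2 * n + p.natAbs by ring] at h
  linear_combination h

/-! ### From the discrete relation to the conclusion -/

theorem IsRadial.mul_norm_pow {h : ℂ → ℂ} (hrad : IsRadial h) (n : ℕ) :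
    IsRadial fun z => h z * (‖z‖ : ℂ) ^ n :=
  fun z hz w hw e => by simp only [hrad z hz w hw e, e]

theorem ae_ne_zero : ∀ᵐ z ∂diskMeasure, z ≠ (0 : ℂ) :=
  Measure.ae_smul_measure (ae_restrict_of_ae (Measure.ae_ne volume 0)) _

/-- A bounded radial function is zero when its weighted radial moments vanish from some point on. -/
theorem ae_eq_zero_of_radial_moments_add {h : ℂ → ℂ} (hrad : IsRadial h)
    (hh : MemLp h ∞ diskMeasure) (m : ℕ)
    (hm : ∀ n : ℕ, ∫ z, h z * (‖z‖ : ℂ) ^ (m + 2 * n) ∂diskMeasure = 0) :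
    h =ᵐ[diskMeasure] 0 := by
  have h0 := ae_eq_zero_of_radial_moments (hrad.mul_norm_pow m) (memLp_mul_norm_pow hh m)
    (fun n => by simpa [mul_assoc, ← pow_add] using hm n)
  -- The function h|z|^m vanishes almost everywhere; |z|^m is divided out off the origin, a null
  -- set.
  filter_upwards [h0, ae_ne_zero] with z hz hz0
  simpa [hz0] using hz

theorem moment_eq_radialEigenvalue_div (ψ : ℂ → ℂ) (n : ℕ) :
    ∫ z, ψ z * (‖z‖ : ℂ) ^ (2 * n) ∂diskMeasure = radialEigenvalue ψ n / (n + 1) := by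
  rw [radialEigenvalue, mul_div_cancel_left₀ _ (Nat.cast_add_one_ne_zero n)]

theorem integral_one_mul_norm_pow (n : ℕ) :
    ∫ z, 1 * (‖z‖ : ℂ) ^ (2 * n) ∂diskMeasure = 1 / (n + 1) := by
  simp only [one_mul]
  rw [integral_norm_pow]
  push_cast
  rw [← mul_add_one, ← div_div, div_self two_ne_zero]

/-- The factor n + 1 in λ(n) prevents λ(n+q) − λ(n) from being used directly as a moment. Divided by
(n+1)(n+q+1) it becomes J·Mq − Jq·M, a combination of products of moments, hence the moment sequence
of a difference of convolutions. The conclusions start at n + 1 because t^s is used only for Re s >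
0, which loses the exponent 0. -/
theorem moments_dichotomy {φ ψ : ℂ → ℂ} (hφ : MemLp φ ∞ diskMeasure)
    (hψ : MemLp ψ ∞ diskMeasure) (q : ℕ)
    (h : ∀ n : ℕ, (∫ z, φ z * (‖z‖ : ℂ) ^ (2 * n + q) ∂diskMeasure) *
      (radialEigenvalue ψ (n + q) - radialEigenvalue ψ n) = 0) :
    (∀ n : ℕ, ∫ z, φ z * (‖z‖ : ℂ) ^ (2 * (n + 1) + q) ∂diskMeasure = 0) ∨
      ∀ n : ℕ, radialEigenvalue ψ (n + 1 + q) = radialEigenvalue ψ (n + 1) := by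
  have iφ := (memLp_mul_norm_pow hφ q).integrable le_top
  have i1 : Integrable (fun _ : ℂ => (1:ℂ)) diskMeasure := integrable_const 1
  have iq := (memLp_mul_norm_pow (memLp_const (1:ℂ)) (2 * q)).integrable le_top
  have iψq := (memLp_mul_norm_pow hψ (2 * q)).integrable le_top
  have iψ := hψ.integrable le_top
  set L := radialFunctional _ iφ
  set J := radialFunctional _ i1
  set Jq := radialFunctional _ iq
  set Mq := radialFunctional _ iψq
  set M := radialFunctional _ iψ
  have eL : ∀ n : ℕ, L (monomialI n) = ∫ z, φ z * (‖z‖ : ℂ) ^ (2 * n + q) ∂diskMeasure := by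
    intro n
    rw [radialFunctional_monomialI]
    congr 1 with z
    ring
  have eJ : ∀ n : ℕ, J (monomialI n) = 1 / (n + 1) := by
    intro n
    rw [radialFunctional_monomialI, integral_one_mul_norm_pow]
  have eJq : ∀ n : ℕ, Jq (monomialI n) = 1 / ((n + q : ℕ) + 1) := by
    intro n
    rw [radialFunctional_monomialI, ← integral_one_mul_norm_pow]
    congr 1 with z
    ring
  have eM : ∀ n : ℕ, M (monomialI n) = radialEigenvalue ψ n / (n + 1) := by
    intro n
    rw [radialFunctional_monomialI, moment_eq_radialEigenvalue_div]
  have eMq : ∀ n : ℕ, Mq (monomialI n) = radialEigenvalue ψ (n + q) / ((n + q : ℕ) + 1) := by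
    intro n
    rw [radialFunctional_monomialI, ← moment_eq_radialEigenvalue_div]
    congr 1 with z
    ring
  have eD : ∀ n : ℕ, J (monomialI n) * Mq (monomialI n) - Jq (monomialI n) * M (monomialI n) =
      (radialEigenvalue ψ (n + q) - radialEigenvalue ψ n) / ((n + 1) * ((n + q : ℕ) + 1)) := by
    intro n
    have h1 : (n : ℂ) + 1 ≠ 0 := Nat.cast_add_one_ne_zero n
    have h2 : ((n + q : ℕ) : ℂ) + 1 ≠ 0 := Nat.cast_add_one_ne_zero _
    rw [eJ, eJq, eM, eMq]
    field_simp
  have hK : mulConv L (mulConv J Mq - mulConv Jq M) = 0 := by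
    refine eq_zero_of_moments fun n => ?_
    rw [mulConv_apply_of_map_mul _ _ (monomialI_mul n), _root_.sub_apply,
      mulConv_apply_of_map_mul _ _ (monomialI_mul n),
      mulConv_apply_of_map_mul _ _ (monomialI_mul n), eD, eL, ← mul_div_assoc, h, zero_div]
  -- The passage from integer to complex exponents: the convolution is zero as a functional, so it
  -- may be evaluated at t^s.
  have hprod : ∀ (s : ℂ) (hs : 0 < s.re), L (cpowI s hs) *
      (J (cpowI s hs) * Mq (cpowI s hs) - Jq (cpowI s hs) * M (cpowI s hs)) = 0 := by
    intro s hs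
    have := congrArg (fun T => T (cpowI s hs)) hK
    simpa only [mulConv_apply_of_map_mul _ _ (cpowI_mul s hs), _root_.sub_apply,
      _root_.zero_apply] using this
  have hopen : IsOpen {s : ℂ | 0 < s.re} := isOpen_lt continuous_const Complex.continuous_re
  have hconn : IsPreconnected {s : ℂ | 0 < s.re} := (convex_halfSpace_re_gt 0).isPreconnected
  have dL := differentiableOn_radialFunctional_cpow iφ
  have dD := ((differentiableOn_radialFunctional_cpow i1).mul
    (differentiableOn_radialFunctional_cpow iψq)).sub
    ((differentiableOn_radialFunctional_cpow iq).mul (differentiableOn_radialFunctional_cpow iψ))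
  have hpos : ∀ n : ℕ, 0 < ((n + 1 : ℕ) : ℂ).re := fun n => by
    rw [Complex.natCast_re]
    positivity
  -- Identity theorem: holomorphic functions on a connected open set have no zero divisors.
  rcases AnalyticOnNhd.eq_zero_or_eq_zero_of_mul_eq_zero (dL.analyticOnNhd hopen)
    (dD.analyticOnNhd hopen) (fun s hs => hprod s hs) hconn with h0 | h0
  · left
    intro n
    rw [← eL, ← cpowI_natCast _ (hpos n)]
    exact h0 _ (hpos n)
  · right
    intro n
    have h1 : J (cpowI _ (hpos n)) * Mq (cpowI _ (hpos n)) -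
      Jq (cpowI _ (hpos n)) * M (cpowI _ (hpos n)) = 0 := h0 _ (hpos n)
    rw [cpowI_natCast, eD, div_eq_zero_iff] at h1
    refine sub_eq_zero.1 (h1.resolve_right (mul_ne_zero ?_ ?_)) <;>
      exact Nat.cast_add_one_ne_zero _

theorem integral_norm_pow_real (n : ℕ) : ∫ z, ‖z‖ ^ (2 * n) ∂diskMeasure = 1 / (n + 1) := by
  have h := integral_one_mul_norm_pow n
  simp only [one_mul, ← Complex.ofReal_pow] at h
  rw [integral_complex_ofReal] at h
  apply Complex.ofReal_injective
  rw [h]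
  push_cast
  rfl

theorem integrable_norm_pow (n : ℕ) : Integrable (fun z : ℂ => ‖z‖ ^ n) diskMeasure := by
  have := ((memLp_mul_norm_pow (memLp_const (1:ℂ)) n).integrable le_top).norm
  simpa using this

/-- The eigenvalues of a radial Toeplitz operator are slowly varying. -/
theorem exists_norm_radialEigenvalue_succ_sub_le {ψ : ℂ → ℂ} (hψ : MemLp ψ ∞ diskMeasure) :
    ∃ C : ℝ, ∀ n : ℕ, ‖radialEigenvalue ψ (n + 1) - radialEigenvalue ψ n‖ ≤ C / (n + 2) := by
  set C := (eLpNormEssSup ψ diskMeasure).toReal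
  have hC : ∀ᵐ z ∂diskMeasure, ‖ψ z‖ ≤ C := by
    filter_upwards [ae_le_eLpNormEssSup (f := ψ) (μ := diskMeasure)] with z hz
    have := ENNReal.toReal_mono (by simpa using hψ.eLpNorm_ne_top) hz
    simpa using this
  refine ⟨C * 2, fun n => ?_⟩
  have i1 := (memLp_mul_norm_pow hψ (2 * (n + 1))).integrable le_top
  have i2 := (memLp_mul_norm_pow hψ (2 * n)).integrable le_top
  have j1 := integrable_norm_pow (2 * n)
  have j2 := integrable_norm_pow (2 * (n + 1))
  have j3 : Integrable (fun z : ℂ => ((n:ℝ) + 1) * (‖z‖ ^ (2 * n) - ‖z‖ ^ (2 * (n + 1))))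
      diskMeasure := (j1.sub j2).const_mul _
  rw [radialEigenvalue, radialEigenvalue, ← integral_const_mul, ← integral_const_mul,
    ← integral_sub (i1.const_mul _) (i2.const_mul _)]
  -- With t = |z|², the kernel (n+2)t^{n+1} − (n+1)t^n is bounded in modulus by (n+1)(t^n − t^{n+1})
  -- + t^{n+1}. Each of the two summands integrates to 1/(n+2).
  have hint : ∫ z, C * (((n:ℝ) + 1) * (‖z‖ ^ (2 * n) - ‖z‖ ^ (2 * (n + 1))) + ‖z‖ ^ (2 * (n + 1)))
      ∂diskMeasure = C * 2 / (n + 2) := by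
    rw [integral_const_mul, integral_add j3 j2, integral_const_mul,
      integral_sub j1 j2, integral_norm_pow_real, integral_norm_pow_real]
    push_cast
    field_simp
    ring
  rw [← hint]
  refine norm_integral_le_of_norm_le ((j3.add j2).const_mul _) ?_
  filter_upwards [hC, ae_mem_ball] with z hz hzb
  have ht1 : ‖z‖ ^ 2 ≤ 1 := pow_le_one₀ (norm_nonneg _) (mem_ball_zero_iff.1 hzb).le
  have e : ((n + 1 : ℕ) + 1 : ℂ) * (ψ z * (‖z‖ : ℂ) ^ (2 * (n + 1))) -
      (n + 1) * (ψ z * (‖z‖ : ℂ) ^ (2 * n)) =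
      ψ z * (((-((n + 1) * (‖z‖ ^ (2 * n) - ‖z‖ ^ (2 * (n + 1)))) +
        ‖z‖ ^ (2 * (n + 1)) : ℝ)) : ℂ) := by
    push_cast
    ring
  rw [e, norm_mul, Complex.norm_real]
  have hd : 0 ≤ ‖z‖ ^ (2 * n) - ‖z‖ ^ (2 * (n + 1)) := by
    rw [mul_add, pow_add, mul_one]
    have : 0 ≤ ‖z‖ ^ (2 * n) := by positivity
    nlinarith
  refine mul_le_mul hz ?_ (norm_nonneg _) ((norm_nonneg _).trans hz)
  refine (norm_add_le _ _).trans (le_of_eq ?_)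
  rw [norm_neg, Real.norm_of_nonneg (by positivity), Real.norm_of_nonneg (by positivity)]

/-- By periodicity a consecutive difference recurs at arbitrarily large indices, where slow
variation makes it arbitrarily small; so it is zero. -/
theorem radialEigenvalue_succ_eq {ψ : ℂ → ℂ} (hψ : MemLp ψ ∞ diskMeasure) {q : ℕ} (hq : q ≠ 0)
    (h : ∀ n : ℕ, radialEigenvalue ψ (n + 1 + q) = radialEigenvalue ψ (n + 1)) (n : ℕ) :
    radialEigenvalue ψ (n + 1) = radialEigenvalue ψ 1 := by
  obtain ⟨C, hC⟩ := exists_norm_radialEigenvalue_succ_sub_le hψ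
  have hper : ∀ n m : ℕ, radialEigenvalue ψ (n + 1 + q * m) = radialEigenvalue ψ (n + 1) := by
    intro n m
    induction m with
    | zero => simp
    | succ m ih =>
      rw [← ih, show n + 1 + q * (m + 1) = (n + q * m) + 1 + q by ring, h]
      congr 1
      ring
  have hstep : ∀ n : ℕ, radialEigenvalue ψ (n + 2) = radialEigenvalue ψ (n + 1) := by
    intro n
    rw [← sub_eq_zero, ← norm_le_zero_iff]
    have hlim : Tendsto (fun m : ℕ => C / (((n + 1 + q * m : ℕ) : ℝ) + 2)) atTop (𝓝 0) := by
      refine tendsto_const_nhds.div_atTop (tendsto_atTop_add_const_right _ _ ?_)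
      refine tendsto_natCast_atTop_atTop.comp (tendsto_atTop_mono (fun m => ?_) tendsto_id)
      have : m ≤ q * m := Nat.le_mul_of_pos_left m (Nat.pos_of_ne_zero hq)
      simp only [id]
      omega
    refine ge_of_tendsto' hlim fun m => ?_
    have := hC (n + 1 + q * m)
    rwa [hper n m, show n + 1 + q * m + 1 = (n + 1) + 1 + q * m by ring, hper (n + 1) m] at this
  induction n with
  | zero => rfl
  | succ n ih => rw [hstep, ih]

end HarmonicBergman

theorem mainTheorem2 (p : ℤ) (hp : p ≠ 0) (φ ψ : ℂ → ℂ)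
    (hφrad : HarmonicBergman.IsRadial φ) (hφ : MemLp φ ∞ HarmonicBergman.diskMeasure)
    (hφnc : ¬ ∃ c : ℂ, φ =ᵐ[HarmonicBergman.diskMeasure] fun _ => c)
    (hψrad : HarmonicBergman.IsRadial ψ) (hψ : MemLp ψ ∞ HarmonicBergman.diskMeasure)
    (hcomm :
      HarmonicBergman.toeplitz ψ hψ ∘L
          HarmonicBergman.toeplitz (HarmonicBergman.quasihomogeneous p φ)
            (HarmonicBergman.memLp_quasihomogeneous p hφ) =
        HarmonicBergman.toeplitz (HarmonicBergman.quasihomogeneous p φ)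
            (HarmonicBergman.memLp_quasihomogeneous p hφ) ∘L
          HarmonicBergman.toeplitz ψ hψ) :
    ∃ c : ℂ, ψ =ᵐ[HarmonicBergman.diskMeasure] fun _ => c := by
  rcases HarmonicBergman.moments_dichotomy hφ hψ p.natAbs
    (HarmonicBergman.eigenvalue_sub_mul_eq_zero_of_commute hφ hψrad hψ hcomm) with h | h
  -- Moments of φ vanishing from exponent 2 + |p| on force φ = 0 almost everywhere, which is a
  -- constant.
  · refine absurd ⟨0, ?_⟩ hφnc
    refine HarmonicBergman.ae_eq_zero_of_radial_moments_add hφrad hφ (2 + p.natAbs) fun n => ?_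
    rw [← h n]
    congr 1 with z
    ring
  · have hc := HarmonicBergman.radialEigenvalue_succ_eq hψ (Int.natAbs_ne_zero.2 hp) h
    refine ⟨HarmonicBergman.radialEigenvalue ψ 1, ?_⟩
    -- The weight |z|^2 skips the moment of order 0, since nothing is known about λ(0) at this
    -- point.
    have h0 := HarmonicBergman.ae_eq_zero_of_radial_moments_add
      (hψrad.sub_const (HarmonicBergman.radialEigenvalue ψ 1))
      (HarmonicBergman.memLp_sub_const hψ _) 2 fun n => by
        rw [show 2 + 2 * n = 2 * (n + 1) by ring,
          HarmonicBergman.integral_sub_const_mul_norm_pow hψ, hc, sub_self, zero_div]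
    filter_upwards [h0] with z hz
    exact sub_eq_zero.1 hz
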